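/- **Syntax.** Let $\mathcal P_1,\mathcal P_2,\mathcal F$ be countable sets of unary predicate, binary predicate and unary function symbols, and let $\gtrdot$ be a total well-founded strict order on $\mathcal F$. $\mathcal F$-terms are built from variables and function symbols; $\mathcal P$-terms are $B(s)$, $S(s,t)$ with $s,t$ $\mathcal F$-terms, and a special constant $\mathsf{TOP}$. Literals are (symmetric) equalities $s\approx t$ and inequalities $s\not\approx t$ between two $\mathcal F$-terms or two $\mathcal P$-terms; an *atom* is $A\approx\mathsf{TOP}$ with $A$ a $\mathcal P$-term $B(s)$ or $S(s,t)$, written just $A$. A *clause* $\Gamma\to\Delta$ consists of a finite set $\Gamma$ of atoms (the body, read as a conjunction) and a finite set $\Delta$ of literals (the head, read as a disjunction), with all variables universally quantified; $\top$ denotes the empty body. $\mathcal O\models\Gamma\to\Delta$ is first-order entailment with equality. A *DL-clause* uses variables $x,z_1,z_2,\dots$; its body atoms are of the form $B(x)$, $S(x,z_i)$, $S(z_i,x)$; its head literals are atoms $B(z_i)$, $B(x)$, $B(f(x))$, $S(x,z_i)$, $S(z_i,x)$, $S(x,f(x))$, $S(f(x),x)$, or (in)equalities between $f(x)$ and $g(x)$,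 $f(x)$ and $z_i$, or $z_i$ and $z_j$; each $z_i$ in the head occurs in the body. An *ontology* $\mathcal O$ is a finite set of DL-clauses. A *query clause* is a DL-clause in which all literals are of the form $B(x)$. *Context terms* are $x$, $y$, $f(x)$, $B(y)$, $B(x)$, $B(f(x))$, $S(x,y)$, $S(y,x)$, $S(x,f(x))$, $S(f(x),x)$ (so $\mathsf{TOP}$ is not one). *Context literals* are the atoms over these $\mathcal P$-terms and the (in)equalities between $f(x)$ and $g(x)$, $f(x)$ and $y$, or $y$ and $y$. A *context clause* has only function-free context atoms in the body and only context literals in the head. $\mathrm{Su}(\mathcal O)$ is the set of the atoms $B(x)$ such that $B(x)$ occurs in a body of $\mathcal O$, $S(x,y)$ such that some $S(x,z_i)$ does, and $S(y,x)$ such that some $S(z_i,x)$ does. $\mathrm{Pr}(\mathcal O)$ consists of the atoms of $\mathrm{Su}(\mathcal O)$ with $x$ and $y$ exchanged, and of $B(y)$ for each unary $B$ occurring in $\mathcal O$. **Orders.** A *context term order* $\succ$ is a strict order on context terms such that (1) $f(x)\succ x\succ y$ for each $f\in\mathcal F$; (2) $f\gtrdot g$ implies $f(x)\succ g(x)$;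 (3) $s_1\succ s_2$ implies $t[s_1]_p\succ t[s_2]_p$ whenever both are context terms; (4) each context term is larger than each of its proper subterms; (5) if $A\in\mathrm{Pr}(\mathcal O)$ and $s\notin\{x,y\}$ is a context term, then $A\not\succ s$. It is extended to $\mathsf{TOP}$ by making $\mathsf{TOP}$ smaller than all context terms, and to literals by the multiset extension, with $s\approx t$ read as $\{s,t\}$ and $s\not\approx t$ as $\{s,s,t,t\}$. For a set $\Delta$ of literals, $\Delta\not\succeq L$ means that no $L'\in\Delta$ satisfies $L'=L$ or $L'\succ L$. A set $U$ of clauses *contains $\Gamma\to\Delta$ up to redundancy*, written $\Gamma\to\Delta\mathrel{\hat\in}U$, if $\{s\approx s',s\not\approx s'\}\subseteq\Delta$ or $s\approx s\in\Delta$ for some terms $s,s'$, or $\Gamma'\subseteq\Gamma$ and $\Delta'\subseteq\Delta$ for some $\Gamma'\to\Delta'\in U$. **Context structures.** A *context structure* for $\mathcal O$ is $\mathcal D=\langle\mathcal V,\mathcal E,\mathcal S,\mathsf{core},\succ\rangle$ with a finite set $\mathcal V$ of contexts, a finite set $\mathcal E\subseteq\mathcal V\times\mathcal V\times\mathcal F$,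 and, for each $v\in\mathcal V$, a finite set $\mathsf{core}_v\subseteq\mathrm{Su}(\mathcal O)$, a finite set $\mathcal S(v)$ of context clauses, and a context term order $\succ_v$. *No rule is applicable to $\mathcal O$ and $\mathcal D$* if all of the following hold for all $u,v\in\mathcal V$ and $f\in\mathcal F$, where $\sigma_f=\{x\mapsto f(x),\,y\mapsto x\}$. - **Core**: if $A\in\mathsf{core}_v$, then $\top\to A\in\mathcal S(v)$. - **Hyper**: if $\bigwedge_{i=1}^n A_i\to\Delta\in\mathcal O$, $\sigma$ is a substitution with $\sigma(x)=x$, and $\Gamma_i\to\Delta_i\vee A_i\sigma\in\mathcal S(v)$ with $\Delta_i\not\succeq_v A_i\sigma$ for $1\le i\le n$, then $\bigwedge_i\Gamma_i\to\Delta\sigma\vee\bigvee_i\Delta_i\mathrel{\hat\in}\mathcal S(v)$. - **Eq**: if $\Gamma_1\to\Delta_1\vee s_1\approx t_1\in\mathcal S(v)$ with $s_1\succ_v t_1$ and $\Delta_1\not\succeq_v s_1\approx t_1$, $\Gamma_2\to\Delta_2\vee s_2\bowtie t_2\in\mathcal S(v)$ with ${\bowtie}\in\{\approx,\not\approx\}$,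 $s_2\succ_v t_2$ and $\Delta_2\not\succeq_v s_2\bowtie t_2$, and $s_2|_p=s_1$, then $\Gamma_1\wedge\Gamma_2\to\Delta_1\vee\Delta_2\vee s_2[t_1]_p\bowtie t_2\mathrel{\hat\in}\mathcal S(v)$. - **Ineq**: if $\Gamma\to\Delta\vee t\not\approx t\in\mathcal S(v)$, then $\Gamma\to\Delta\mathrel{\hat\in}\mathcal S(v)$. - **Factor**: if $\Gamma\to\Delta\vee s\approx t\vee s\approx t'\in\mathcal S(v)$ with $\Delta\cup\{s\approx t\}\not\succeq_v s\approx t'$ and $s\succ_v t'$, then $\Gamma\to\Delta\vee t\not\approx t'\vee s\approx t'\mathrel{\hat\in}\mathcal S(v)$. - **Elim**: no $C\in\mathcal S(v)$ satisfies $C\mathrel{\hat\in}\mathcal S(v)\setminus\{C\}$. - **Pred**: if $\langle u,v,f\rangle\in\mathcal E$, $\bigwedge_{i=1}^{l}A_i\to\bigvee_{i=l+1}^{l+n}A_i\in\mathcal S(v)$ with $A_i\in\mathrm{Pr}(\mathcal O)$ for $l<i\le l+n$, and $\Gamma_i\to\Delta_i\vee A_i\sigma_f\in\mathcal S(u)$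 with $\Delta_i\not\succeq_u A_i\sigma_f$ for $1\le i\le l$, then $\bigwedge_{i=1}^l\Gamma_i\to\bigvee_{i=1}^l\Delta_i\vee\bigvee_{i=l+1}^{l+n}A_i\sigma_f\mathrel{\hat\in}\mathcal S(u)$. - **Succ**: if $\Gamma\to\Delta\vee A\in\mathcal S(u)$ with $A$ an atom containing $f(x)$ and $\Delta\not\succeq_u A$, then there is an edge $\langle u,w,f\rangle\in\mathcal E$ such that $A'\to A'\mathrel{\hat\in}\mathcal S(w)$ for each $A'\in K_2\setminus\mathsf{core}_w$, where $K_2$ is the set of those $A'\in\mathrm{Su}(\mathcal O)$ for which some $\Gamma'\to\Delta'\vee A'\sigma_f\in\mathcal S(u)$ satisfies $\Delta'\not\succeq_u A'\sigma_f$. **Theorem (Completeness).** Let $\mathcal O$ be an ontology and let $\mathcal D=\langle\mathcal V,\mathcal E,\mathcal S,\mathsf{core},\succ\rangle$ be a context structure for $\mathcal O$ such that no rule is applicable to $\mathcal O$ and $\mathcal D$. Then $\Gamma_Q\to\Delta_Q\mathrel{\hat\in}\mathcal S(q)$ holds for each query clause $\Gamma_Q\to\Delta_Q$ and each context $q\in\mathcal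 V$ such that - **C1.** $\mathcal O\models\Gamma_Q\to\Delta_Q$; - **C2.** for each atom $A\in\Delta_Q$ and each context term $s\notin\{x,y\}$, if $A\succ_q s$, then $s\approx\mathsf{TOP}\in\Delta_Q\cup\mathrm{Pr}(\mathcal O)$; - **C3.** for each $A\in\Gamma_Q$, we have $\Gamma_Q\to A\mathrel{\hat\in}\mathcal S(q)$. -/

import Mathlib

universe u

namespace ConsequenceBased

section Terms

/-- Variables: the central variable `x`, the predecessor variable `y` of context clauses, and the
neighbour variables `z i` of DL-clauses. -/
inductive Var : Type
  | x : Var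
  | y : Var
  | z (i : ℕ) : Var

/-- `F`-terms, built from variables and unary function symbols. -/
inductive FTerm (F : Type u) : Type u
  | var (v : Var) : FTerm F
  | app (f : F) (t : FTerm F) : FTerm F

/-- `P`-terms other than the constant `TOP`: `B(t)` and `S(s,t)`. Such a `P`-term is identified with
the atom `B(t) ≈ TOP`, respectively `S(s,t) ≈ TOP`; see `Atom.lit`. -/
inductive Atom (F P₁ P₂ : Type u) : Type u
  | un (B : P₁) (t : FTerm F) : Atom F P₁ P₂
  | bin (S : P₂) (s t : FTerm F) : Atom F P₁ P₂

/-- Terms: `F`-terms, and `P`-terms (including the special constant `TOP`). Predicate symbols occur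
at the outermost level only. -/
inductive Term (F P₁ P₂ : Type u) : Type u
  | fterm (t : FTerm F) : Term F P₁ P₂
  | atom (A : Atom F P₁ P₂) : Term F P₁ P₂
  | top : Term F P₁ P₂

/-- Literals: equalities (`pos = true`) and inequalities (`pos = false`). They are symmetric, so the
two sides form an unordered pair. -/
structure Literal (F P₁ P₂ : Type u) : Type u where
  pos : Bool
  sides : Sym2 (Term F P₁ P₂)

/-- Clauses `Γ → Δ`, with `Γ` a finite set of atoms and `Δ` a finite set of literals. -/
@[ext]
structure Clause (F P₁ P₂ : Type u) : Type u where
  body : Finset (Atom F P₁ P₂)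
  head : Finset (Literal F P₁ P₂)

variable {F P₁ P₂ : Type u}

/-- The term `x`. -/
abbrev FTerm.x : FTerm F := .var .x
/-- The term `y`. -/
abbrev FTerm.y : FTerm F := .var .y
/-- The term `z i`. -/
abbrev FTerm.z (i : ℕ) : FTerm F := .var (.z i)
/-- The term `f(x)`. -/
abbrev FTerm.fx (f : F) : FTerm F := .app f (.var .x)

/-- The equality `s ≈ t`. -/
def Literal.eq (s t : Term F P₁ P₂) : Literal F P₁ P₂ := ⟨true, s(s, t)⟩
/-- The inequality `s ≉ t`. -/
def Literal.ne (s t : Term F P₁ P₂) : Literal F P₁ P₂ := ⟨false, s(s, t)⟩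
/-- The `P`-term `A` as the formula `A ≈ TOP`. -/
def Atom.lit (A : Atom F P₁ P₂) : Literal F P₁ P₂ := .eq (.atom A) .top

/-- Application of a substitution. -/
def FTerm.subst (σ : Var → FTerm F) : FTerm F → FTerm F
  | .var v => σ v
  | .app f t => .app f (t.subst σ)

def Atom.subst (σ : Var → FTerm F) : Atom F P₁ P₂ → Atom F P₁ P₂
  | .un B t => .un B (t.subst σ)
  | .bin S s t => .bin S (s.subst σ) (t.subst σ)

def Term.subst (σ : Var → FTerm F) : Term F P₁ P₂ → Term F P₁ P₂
  | .fterm t => .fterm (t.subst σ)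
  | .atom A => .atom (A.subst σ)
  | .top => .top

def Literal.subst (σ : Var → FTerm F) (L : Literal F P₁ P₂) : Literal F P₁ P₂ :=
  ⟨L.pos, L.sides.map (Term.subst σ)⟩

/-- `s.IsSubterm t`: the term `s` is the subterm of `t` at some (not necessarily proper)
position. -/
def FTerm.IsSubterm (s : FTerm F) : FTerm F → Prop
  | .var v => s = .var v
  | .app f t => s = .app f t ∨ FTerm.IsSubterm s t

def Term.IsSubterm (s : Term F P₁ P₂) : Term F P₁ P₂ → Prop
  | .fterm t => ∃ s', s = .fterm s' ∧ s'.IsSubterm t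
  | .atom (.un B t) => s = .atom (.un B t) ∨ ∃ s', s = .fterm s' ∧ s'.IsSubterm t
  | .atom (.bin S t₁ t₂) =>
      s = .atom (.bin S t₁ t₂) ∨ ∃ s', s = .fterm s' ∧ (s'.IsSubterm t₁ ∨ s'.IsSubterm t₂)
  | .top => s = .top

/-- `FTerm.Replace s t u w`: there is a position `p` such that `u` has the subterm `s` at `p`, and
`w` is obtained from `u` by replacing that occurrence with `t`. In other words, `u = t'[s]_p` and
`w = t'[t]_p` for some term `t'` and some position `p` in it. -/
inductive FTerm.Replace (s t : FTerm F) : FTerm F → FTerm F → Prop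
  | root : FTerm.Replace s t s t
  | app (f : F) {u w : FTerm F} : FTerm.Replace s t u w → FTerm.Replace s t (.app f u) (.app f w)

/-- The same relation on all terms. -/
inductive Term.Replace : Term F P₁ P₂ → Term F P₁ P₂ → Term F P₁ P₂ → Term F P₁ P₂ → Prop
  | root (s t : Term F P₁ P₂) : Term.Replace s t s t
  | fterm {s t u w : FTerm F} : FTerm.Replace s t u w →
      Term.Replace (.fterm s) (.fterm t) (.fterm u) (.fterm w)
  | un (B : P₁) {s t u w : FTerm F} : FTerm.Replace s t u w →
      Term.Replace (.fterm s) (.fterm t) (.atom (.un B u)) (.atom (.un B w))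
  | binLeft (S : P₂) (r : FTerm F) {s t u w : FTerm F} : FTerm.Replace s t u w →
      Term.Replace (.fterm s) (.fterm t) (.atom (.bin S u r)) (.atom (.bin S w r))
  | binRight (S : P₂) (r : FTerm F) {s t u w : FTerm F} : FTerm.Replace s t u w →
      Term.Replace (.fterm s) (.fterm t) (.atom (.bin S r u)) (.atom (.bin S r w))

/-- The variable `v` occurs in a term. -/
def FTerm.HasVar (v : Var) : FTerm F → Prop
  | .var w => v = w
  | .app _ t => FTerm.HasVar v t

def Atom.HasVar (v : Var) : Atom F P₁ P₂ → Prop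
  | .un _ t => t.HasVar v
  | .bin _ s t => s.HasVar v ∨ t.HasVar v

def Term.HasVar (v : Var) : Term F P₁ P₂ → Prop
  | .fterm t => t.HasVar v
  | .atom A => A.HasVar v
  | .top => False

end Terms

section Semantics

variable {F P₁ P₂ : Type u}

/-- A first-order interpretation of the signature with domain `U`. -/
structure Interp (F P₁ P₂ U : Type u) : Type u where
  fn : F → U → U
  un : P₁ → U → Prop
  bin : P₂ → U → U → Prop

variable {U : Type u}

def Interp.evalF (I : Interp F P₁ P₂ U) (ν : Var → U) : FTerm F → U
  | .var v => ν v
  | .app f t => I.fn f (I.evalF ν t)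

def Interp.evalA (I : Interp F P₁ P₂ U) (ν : Var → U) : Atom F P₁ P₂ → Prop
  | .un B t => I.un B (I.evalF ν t)
  | .bin S s t => I.bin S (I.evalF ν s) (I.evalF ν t)

/-- `F`-terms denote elements of the domain, `P`-terms denote truth values, `TOP` denotes truth. -/
def Interp.eval (I : Interp F P₁ P₂ U) (ν : Var → U) : Term F P₁ P₂ → U ⊕ Prop
  | .fterm t => .inl (I.evalF ν t)
  | .atom A => .inr (I.evalA ν A)
  | .top => .inr True

/-- `s ≈ t` holds iff `s` and `t` have the same value, and `s ≉ t` is its negation. -/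
def Interp.holdsL (I : Interp F P₁ P₂ U) (ν : Var → U) (L : Literal F P₁ P₂) : Prop :=
  (L.sides.map (I.eval ν)).IsDiag ↔ L.pos = true

/-- Satisfaction of a clause; its variables are universally quantified. -/
def Interp.models (I : Interp F P₁ P₂ U) (C : Clause F P₁ P₂) : Prop :=
  ∀ ν : Var → U, (∀ A ∈ C.body, I.evalA ν A) → ∃ L ∈ C.head, I.holdsL ν L

/-- Entailment `O ⊨ Γ → Δ` of a clause from a set of clauses. -/
def Entails (O : Set (Clause F P₁ P₂)) (C : Clause F P₁ P₂) : Prop :=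
  ∀ (U : Type u) [Nonempty U] (I : Interp F P₁ P₂ U), (∀ C' ∈ O, I.models C') → I.models C

end Semantics

section DLClauses

variable {F P₁ P₂ : Type u}

/-- DL-`P`-terms. -/
inductive IsDLPTerm : Atom F P₁ P₂ → Prop
  | Bz (B : P₁) (i : ℕ) : IsDLPTerm (.un B (.z i))
  | Bx (B : P₁) : IsDLPTerm (.un B .x)
  | Bf (B : P₁) (f : F) : IsDLPTerm (.un B (.fx f))
  | Sxz (S : P₂) (i : ℕ) : IsDLPTerm (.bin S .x (.z i))
  | Szx (S : P₂) (i : ℕ) : IsDLPTerm (.bin S (.z i) .x)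
  | Sxf (S : P₂) (f : F) : IsDLPTerm (.bin S .x (.fx f))
  | Sfx (S : P₂) (f : F) : IsDLPTerm (.bin S (.fx f) .x)

/-- DL-literals. -/
inductive IsDLLiteral : Literal F P₁ P₂ → Prop
  | atom {A : Atom F P₁ P₂} (hA : IsDLPTerm A) : IsDLLiteral A.lit
  | ff (pos : Bool) (f g : F) : IsDLLiteral ⟨pos, s(.fterm (.fx f), .fterm (.fx g))⟩
  | fz (pos : Bool) (f : F) (i : ℕ) : IsDLLiteral ⟨pos, s(.fterm (.fx f), .fterm (.z i))⟩
  | zz (pos : Bool) (i j : ℕ) : IsDLLiteral ⟨pos, s(.fterm (.z i), .fterm (.z j))⟩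

/-- The atoms allowed in the body of a DL-clause. -/
inductive IsDLBodyAtom : Atom F P₁ P₂ → Prop
  | Bx (B : P₁) : IsDLBodyAtom (.un B .x)
  | Sxz (S : P₂) (i : ℕ) : IsDLBodyAtom (.bin S .x (.z i))
  | Szx (S : P₂) (i : ℕ) : IsDLBodyAtom (.bin S (.z i) .x)

/-- DL-clauses. -/
structure IsDLClause (C : Clause F P₁ P₂) : Prop where
  body : ∀ A ∈ C.body, IsDLBodyAtom A
  head : ∀ L ∈ C.head, IsDLLiteral L
  safe : ∀ i : ℕ, (∃ L ∈ C.head, ∃ t ∈ L.sides, t.HasVar (.z i)) → ∃ A ∈ C.body, A.HasVar (.z i)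

/-- Query clauses: DL-clauses all of whose literals have the form `B(x)`. -/
structure IsQueryClause (C : Clause F P₁ P₂) : Prop where
  dl : IsDLClause C
  body : ∀ A ∈ C.body, ∃ B : P₁, A = .un B .x
  head : ∀ L ∈ C.head, ∃ B : P₁, L = Atom.lit (.un B .x)

/-- An ontology is a finite set of DL-clauses. -/
structure Ontology (F P₁ P₂ : Type u) : Type u where
  clauses : Finset (Clause F P₁ P₂)
  dl : ∀ C ∈ clauses, IsDLClause C

end DLClauses

section Contexts

variable {F P₁ P₂ : Type u}

/-- Context `F`-terms `x`, `y`, `f(x)`. -/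
inductive IsContextFTerm : FTerm F → Prop
  | x : IsContextFTerm .x
  | y : IsContextFTerm .y
  | fx (f : F) : IsContextFTerm (.fx f)

/-- Function-free context `P`-terms. -/
inductive IsFunctionFreeContextPTerm : Atom F P₁ P₂ → Prop
  | By (B : P₁) : IsFunctionFreeContextPTerm (.un B .y)
  | Bx (B : P₁) : IsFunctionFreeContextPTerm (.un B .x)
  | Sxy (S : P₂) : IsFunctionFreeContextPTerm (.bin S .x .y)
  | Syx (S : P₂) : IsFunctionFreeContextPTerm (.bin S .y .x)

/-- Context `P`-terms. -/
inductive IsContextPTerm : Atom F P₁ P₂ → Prop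
  | free {A : Atom F P₁ P₂} (hA : IsFunctionFreeContextPTerm A) : IsContextPTerm A
  | Bf (B : P₁) (f : F) : IsContextPTerm (.un B (.fx f))
  | Sxf (S : P₂) (f : F) : IsContextPTerm (.bin S .x (.fx f))
  | Sfx (S : P₂) (f : F) : IsContextPTerm (.bin S (.fx f) .x)

/-- Context terms. The constant `TOP` is not one of them. -/
def IsContextTerm : Term F P₁ P₂ → Prop
  | .fterm t => IsContextFTerm t
  | .atom A => IsContextPTerm A
  | .top => False

/-- Context literals. -/
inductive IsContextLiteral : Literal F P₁ P₂ → Prop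
  | atom {A : Atom F P₁ P₂} (hA : IsContextPTerm A) : IsContextLiteral A.lit
  | ff (pos : Bool) (f g : F) : IsContextLiteral ⟨pos, s(.fterm (.fx f), .fterm (.fx g))⟩
  | fy (pos : Bool) (f : F) : IsContextLiteral ⟨pos, s(.fterm (.fx f), .fterm .y)⟩
  | yy (pos : Bool) : IsContextLiteral ⟨pos, s(.fterm .y, .fterm .y)⟩

/-- Context clauses. -/
structure IsContextClause (C : Clause F P₁ P₂) : Prop where
  body : ∀ A ∈ C.body, IsFunctionFreeContextPTerm A
  head : ∀ L ∈ C.head, IsContextLiteral L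

/-- The successor triggers `Su(O)`. -/
inductive Su (O : Ontology F P₁ P₂) : Set (Atom F P₁ P₂)
  | Bx {C : Clause F P₁ P₂} (hC : C ∈ O.clauses) {B : P₁} (h : .un B .x ∈ C.body) :
      Su O (.un B .x)
  | Sxy {C : Clause F P₁ P₂} (hC : C ∈ O.clauses) {S : P₂} {i : ℕ} (h : .bin S .x (.z i) ∈ C.body) :
      Su O (.bin S .x .y)
  | Syx {C : Clause F P₁ P₂} (hC : C ∈ O.clauses) {S : P₂} {i : ℕ} (h : .bin S (.z i) .x ∈ C.body) :
      Su O (.bin S .y .x)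

/-- The substitution `{x ↦ y, y ↦ x}`. -/
def swapSubst : Var → FTerm F
  | .x => .y
  | .y => .x
  | .z i => .z i

/-- The substitution `{x ↦ f(x), y ↦ x}`. -/
def succSubst (f : F) : Var → FTerm F
  | .x => .fx f
  | .y => .x
  | .z i => .z i

/-- The unary predicate `B` occurs in `O`. -/
def Ontology.HasUnary (O : Ontology F P₁ P₂) (B : P₁) : Prop :=
  ∃ C ∈ O.clauses, ∃ t : FTerm F,
    .un B t ∈ C.body ∨ ∃ L ∈ C.head, Term.atom (.un B t) ∈ L.sides

/-- The predecessor triggers `Pr(O)`. -/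
def Pr (O : Ontology F P₁ P₂) : Set (Atom F P₁ P₂) :=
  {A' | ∃ A ∈ Su O, A' = A.subst swapSubst} ∪ {A' | ∃ B : P₁, O.HasUnary B ∧ A' = .un B .y}

/-- Context term orders, where `f ⋗ g` on function symbols is `g < f`: strict orders on the set of
context terms with the five conditions below. -/
structure IsContextTermOrder [LinearOrder F] (O : Ontology F P₁ P₂)
    (gt : Term F P₁ P₂ → Term F P₁ P₂ → Prop) : Prop where
  field : ∀ s t, gt s t → IsContextTerm s ∧ IsContextTerm t
  irrefl : ∀ s, ¬ gt s s
  trans : ∀ s t r, gt s t → gt t r → gt s r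
  fxy : ∀ f : F, gt (.fterm (.fx f)) (.fterm .x) ∧ gt (.fterm .x) (.fterm .y)
  fun_gt : ∀ f g : F, g < f → gt (.fterm (.fx f)) (.fterm (.fx g))
  mono : ∀ s₁ s₂ u w : Term F P₁ P₂, gt s₁ s₂ → Term.Replace s₁ s₂ u w →
    IsContextTerm u → IsContextTerm w → gt u w
  subterm : ∀ s u : Term F P₁ P₂, IsContextTerm s → u.IsSubterm s → u ≠ s → gt s u
  pr : ∀ A ∈ Pr O, ∀ s : Term F P₁ P₂, IsContextTerm s → s ≠ .fterm .x → s ≠ .fterm .y →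
    ¬ gt (.atom A) s

end Contexts

section LiteralOrder

variable {F P₁ P₂ : Type u}

/-- A context term order, extended to `TOP` by making `TOP` smaller than every context term. -/
def topExt (gt : Term F P₁ P₂ → Term F P₁ P₂ → Prop) (s t : Term F P₁ P₂) : Prop :=
  gt s t ∨ (IsContextTerm s ∧ t = .top)

open Classical in
/-- The multiset extension of a strict order. -/
def mulGt {α : Type u} (gt : α → α → Prop) (M N : Multiset α) : Prop :=
  M ≠ N ∧ ∀ n ∈ N - M, ∃ m ∈ M - N, gt m n

/-- `s ≈ t` is identified with `{s, t}`, and `s ≉ t` with `{s, s, t, t}`. -/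
def Literal.multiset (L : Literal F P₁ P₂) : Multiset (Term F P₁ P₂) :=
  if L.pos then L.sides.toMultiset else L.sides.toMultiset + L.sides.toMultiset

/-- The literal order induced by a context term order. -/
def litGt (gt : Term F P₁ P₂ → Term F P₁ P₂ → Prop) (L L' : Literal F P₁ P₂) : Prop :=
  mulGt (topExt gt) L.multiset L'.multiset

/-- `Δ ⪰ L`: some literal of `Δ` is equal to or larger than `L`. -/
def headGe (gt : Term F P₁ P₂ → Term F P₁ P₂ → Prop) (Δ : Finset (Literal F P₁ P₂))
    (L : Literal F P₁ P₂) : Prop :=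
  ∃ L' ∈ Δ, L' = L ∨ litGt gt L' L

end LiteralOrder

/-- `ContainsUpToRedundancy U C`: the set of clauses `U` contains `C` up to redundancy. -/
def ContainsUpToRedundancy {F P₁ P₂ : Type u} (U : Set (Clause F P₁ P₂)) (C : Clause F P₁ P₂) :
    Prop :=
  (∃ s s' : Term F P₁ P₂, Literal.eq s s' ∈ C.head ∧ Literal.ne s s' ∈ C.head) ∨
  (∃ s : Term F P₁ P₂, Literal.eq s s ∈ C.head) ∨
  (∃ C' ∈ U, C'.body ⊆ C.body ∧ C'.head ⊆ C.head)

/-- A context structure for `O` with the set `V` of contexts. -/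
structure ContextStructure {F P₁ P₂ : Type u} [LinearOrder F] (O : Ontology F P₁ P₂)
    (V : Type*) where
  finite_contexts : Finite V
  /-- `(u, v, f) ∈ E` is an `f`-labelled edge from `u` to `v`. -/
  E : Finset (V × V × F)
  S : V → Finset (Clause F P₁ P₂)
  core : V → Finset (Atom F P₁ P₂)
  gt : V → Term F P₁ P₂ → Term F P₁ P₂ → Prop
  clauses_context : ∀ v, ∀ C ∈ S v, IsContextClause C
  core_su : ∀ v, ∀ A ∈ core v, A ∈ Su O
  order : ∀ v, IsContextTermOrder O (gt v)

namespace ContextStructure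

variable {F P₁ P₂ : Type u} [LinearOrder F] {O : Ontology F P₁ P₂} {V : Type*}

/-- `C` is contained in `S(v)` up to redundancy. -/
def Has (D : ContextStructure O V) (v : V) (C : Clause F P₁ P₂) : Prop :=
  ContainsUpToRedundancy (D.S v : Set (Clause F P₁ P₂)) C

open Classical in
/-- `Γ → Δ ∨ L ∈ S(v)` and `Δ ⋡ L`. -/
def MaximalIn (D : ContextStructure O V) (v : V) (Γ : Finset (Atom F P₁ P₂))
    (Δ : Finset (Literal F P₁ P₂)) (L : Literal F P₁ P₂) : Prop :=
  ⟨Γ, insert L Δ⟩ ∈ D.S v ∧ ¬ headGe (D.gt v) Δ L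

/-- The Core rule is applicable. -/
def CoreApplicable (D : ContextStructure O V) : Prop :=
  ∃ v, ∃ A ∈ D.core v, (⟨∅, {A.lit}⟩ : Clause F P₁ P₂) ∉ D.S v

open Classical in
/-- The Hyper rule is applicable. The premise used for the body atom `A` is
`Γ A → Δ A ∨ Aσ`. -/
def HyperApplicable (D : ContextStructure O V) : Prop :=
  ∃ v, ∃ C ∈ O.clauses, ∃ σ : Var → FTerm F, σ .x = .x ∧
    ∃ (Γ : Atom F P₁ P₂ → Finset (Atom F P₁ P₂)) (Δ : Atom F P₁ P₂ → Finset (Literal F P₁ P₂)),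
      (∀ A ∈ C.body, D.MaximalIn v (Γ A) (Δ A) (A.subst σ).lit) ∧
      ¬ D.Has v ⟨C.body.biUnion Γ, C.head.image (Literal.subst σ) ∪ C.body.biUnion Δ⟩

open Classical in
/-- The Eq rule is applicable; `w` is `s₂` with an occurrence of `s₁` replaced by `t₁`. -/
def EqApplicable (D : ContextStructure O V) : Prop :=
  ∃ (v : V) (Γ₁ Γ₂ : Finset (Atom F P₁ P₂)) (Δ₁ Δ₂ : Finset (Literal F P₁ P₂))
    (s₁ t₁ s₂ t₂ w : Term F P₁ P₂) (pos : Bool),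
    D.MaximalIn v Γ₁ Δ₁ (.eq s₁ t₁) ∧ topExt (D.gt v) s₁ t₁ ∧
    D.MaximalIn v Γ₂ Δ₂ ⟨pos, s(s₂, t₂)⟩ ∧ topExt (D.gt v) s₂ t₂ ∧
    Term.Replace s₁ t₁ s₂ w ∧
    ¬ D.Has v ⟨Γ₁ ∪ Γ₂, Δ₁ ∪ Δ₂ ∪ {⟨pos, s(w, t₂)⟩}⟩

open Classical in
/-- The Ineq rule is applicable. -/
def IneqApplicable (D : ContextStructure O V) : Prop :=
  ∃ (v : V) (Γ : Finset (Atom F P₁ P₂)) (Δ : Finset (Literal F P₁ P₂)) (t : Term F P₁ P₂),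
    ⟨Γ, insert (.ne t t) Δ⟩ ∈ D.S v ∧ ¬ D.Has v ⟨Γ, Δ⟩

open Classical in
/-- The Factor rule is applicable. -/
def FactorApplicable (D : ContextStructure O V) : Prop :=
  ∃ (v : V) (Γ : Finset (Atom F P₁ P₂)) (Δ : Finset (Literal F P₁ P₂)) (s t t' : Term F P₁ P₂),
    D.MaximalIn v Γ (insert (.eq s t) Δ) (.eq s t') ∧ topExt (D.gt v) s t' ∧
    ¬ D.Has v ⟨Γ, Δ ∪ {.ne t t', .eq s t'}⟩

/-- The Elim rule is applicable. -/
def ElimApplicable (D : ContextStructure O V) : Prop :=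
  ∃ v, ∃ C ∈ D.S v, ContainsUpToRedundancy ((D.S v : Set (Clause F P₁ P₂)) \ {C}) C

open Classical in
/-- The Pred rule is applicable. The premise used for the body atom `A` is
`Γ A → Δ A ∨ Aσ`. -/
def PredApplicable (D : ContextStructure O V) : Prop :=
  ∃ u v f, (u, v, f) ∈ D.E ∧ ∃ C ∈ D.S v, (∀ L ∈ C.head, ∃ A ∈ Pr O, L = A.lit) ∧
    ∃ (Γ : Atom F P₁ P₂ → Finset (Atom F P₁ P₂)) (Δ : Atom F P₁ P₂ → Finset (Literal F P₁ P₂)),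
      (∀ A ∈ C.body, D.MaximalIn u (Γ A) (Δ A) (A.subst (succSubst f)).lit) ∧
      ¬ D.Has u ⟨C.body.biUnion Γ, C.body.biUnion Δ ∪ C.head.image (Literal.subst (succSubst f))⟩

/-- The set `K₂` of the Succ rule for the context `u` and the function symbol `f`. -/
def K₂ (D : ContextStructure O V) (u : V) (f : F) : Set (Atom F P₁ P₂) :=
  {A' | A' ∈ Su O ∧ ∃ Γ' Δ', D.MaximalIn u Γ' Δ' (A'.subst (succSubst f)).lit}

/-- The Succ rule is applicable. -/
def SuccApplicable (D : ContextStructure O V) : Prop :=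
  ∃ (u : V) (f : F) (Γ : Finset (Atom F P₁ P₂)) (Δ : Finset (Literal F P₁ P₂))
    (A : Atom F P₁ P₂),
    D.MaximalIn u Γ Δ A.lit ∧ (Term.fterm (.fx f)).IsSubterm (.atom A) ∧
    ¬ ∃ v, (u, v, f) ∈ D.E ∧ ∀ A' ∈ D.K₂ u f, A' ∉ D.core v → D.Has v ⟨{A'}, {A'.lit}⟩

/-- No inference rule is applicable to `O` and `D`. -/
def Saturated (D : ContextStructure O V) : Prop :=
  ¬ (D.CoreApplicable ∨ D.HyperApplicable ∨ D.EqApplicable ∨ D.IneqApplicable ∨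
    D.FactorApplicable ∨ D.ElimApplicable ∨ D.PredApplicable ∨ D.SuccApplicable)

end ContextStructure

end ConsequenceBased

/-! If `Q` is not contained in `S(q)` up to redundancy, there is a model of `O` that refutes `Q`,
contradicting C1. Its elements are the lists of function symbols, viewed as a tree. Every element
carries a local interpretation of `x`, `y` and the terms `f(x)`, read off the clauses of one
context: `y` stands for the parent, and an irreducible `f(x)` for the `f`-child.

A local interpretation comes from the model construction of ordered superposition. Let `Γ` be the
atoms to be made true and `Λ` those to be made false, where no clause of `S(v)` with body in `Γ` has
its head within `Λ` (`Refutable`). The order of the context is extended to a linear order with the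
atoms of `Λ` near the bottom (`IsContextTermOrder.exists_isAdmissible`). Going up this order,
clauses whose other literals are smaller and false produce rules `f(x) ⇒ t` and `A ⇒ TOP`
(`exists_values`). A false clause could be reduced by Eq, Ineq or Factor to a smaller false clause
(`exists_smaller`), so a minimal one does not exist. A clause producing an atom of `Λ` would have
its whole head in `Λ`, so these atoms stay false (`Refutable.exists_isLocalModel`).

The local models are glued along the tree. When a fact mentions `f(x)`, Succ yields a context for
the `f`-child. There `Γ` consists of the successor triggers true at the parent and `Λ` of the
predecessor triggers false at the parent; Pred shows that this pair is refutable
(`exists_isSuccessor`). Hence neighbours exchange all triggers (`facts_down`, `facts_up`). Body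
atoms of DL-clauses are triggers up to renaming, so a body that is true in the tree is true in one
local model (`body_facts`), and Hyper then makes the head true (`treeModel_models`).

The root has no parent, so every clause whose head mentions `y` is ignored there; the proposition
`p` records whether `y` may be used. Conditions C2 and C3 make the query refutable in this
restricted sense (`refutable_root`). -/

namespace ConsequenceBased

/-! ### Local interpretations, visible literals and shapes of context literals -/

section LocalInterpretations

variable {F P₁ P₂ : Type u}

/-- Application of a function to the immediate arguments of an atom. -/
def Atom.mapF (h : FTerm F → FTerm F) : Atom F P₁ P₂ → Atom F P₁ P₂
  | .un B t => .un B (h t)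
  | .bin S s t => .bin S (h s) (h t)

/-- An interpretation of the context terms of a single context: a normal form for each `F`-term and
the set of the true atoms between normal forms. -/
structure LocalInterp (F P₁ P₂ : Type u) : Type u where
  nf : FTerm F → FTerm F
  facts : Set (Atom F P₁ P₂)

def LocalInterp.eval (J : LocalInterp F P₁ P₂) : Term F P₁ P₂ → FTerm F ⊕ Prop
  | .fterm t => .inl (J.nf t)
  | .atom A => .inr (A.mapF J.nf ∈ J.facts)
  | .top => .inr True

def LocalInterp.holds (J : LocalInterp F P₁ P₂) (L : Literal F P₁ P₂) : Prop :=
  (L.sides.map J.eval).IsDiag ↔ L.pos = true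

theorem LocalInterp.holds_mk (J : LocalInterp F P₁ P₂) (pos : Bool) (s t : Term F P₁ P₂) :
    J.holds ⟨pos, s(s, t)⟩ ↔ (J.eval s = J.eval t ↔ pos = true) := by
  simp [holds]

theorem LocalInterp.holds_eq (J : LocalInterp F P₁ P₂) (s t : Term F P₁ P₂) :
    J.holds (.eq s t) ↔ J.eval s = J.eval t := by
  simp [Literal.eq, holds_mk]

theorem LocalInterp.holds_ne (J : LocalInterp F P₁ P₂) (s t : Term F P₁ P₂) :
    J.holds (.ne s t) ↔ J.eval s ≠ J.eval t := by
  simp [Literal.ne, holds_mk]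

theorem LocalInterp.holds_lit (J : LocalInterp F P₁ P₂) (A : Atom F P₁ P₂) :
    J.holds A.lit ↔ A.mapF J.nf ∈ J.facts := by
  simp [Atom.lit, holds_eq, eval]

theorem LocalInterp.holds_congr {J J' : LocalInterp F P₁ P₂} {L : Literal F P₁ P₂}
    (h : ∀ t ∈ L.sides, J.eval t = J'.eval t) : J.holds L ↔ J'.holds L := by
  obtain ⟨pos, s⟩ := L
  induction s with
  | _ a b => simp only [holds_mk, h a (Sym2.mem_mk_left a b), h b (Sym2.mem_mk_right a b)]

theorem Atom.lit_injective {A A' : Atom F P₁ P₂} (h : A.lit = A'.lit) : A = A' := by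
  simpa [Atom.lit, Literal.eq] using h

/-- A clause that is contained in `U` up to redundancy but fails in a local interpretation is
subsumed by a clause of `U`. -/
theorem ContainsUpToRedundancy.exists_subset {U : Set (Clause F P₁ P₂)} {C : Clause F P₁ P₂}
    (h : ContainsUpToRedundancy U C) (J : LocalInterp F P₁ P₂) (hJ : ∀ L ∈ C.head, ¬ J.holds L) :
    ∃ C' ∈ U, C'.body ⊆ C.body ∧ C'.head ⊆ C.head := by
  rcases h with ⟨s, s', h₁, h₂⟩ | ⟨s, h⟩ | h
  · have h₁ := hJ _ h₁
    have h₂ := hJ _ h₂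
    rw [J.holds_eq] at h₁
    rw [J.holds_ne] at h₂
    exact absurd h₁ h₂
  · exact absurd ((J.holds_eq s s).2 rfl) (hJ _ h)
  · exact h

/-- A clause whose head consists of atoms is contained up to redundancy only if it is subsumed. -/
theorem ContainsUpToRedundancy.exists_subset_of_atoms {U : Set (Clause F P₁ P₂)}
    {C : Clause F P₁ P₂} (h : ContainsUpToRedundancy U C) (hC : ∀ L ∈ C.head, ∃ A, L = Atom.lit A) :
    ∃ C' ∈ U, C'.body ⊆ C.body ∧ C'.head ⊆ C.head := by
  -- The interpretation without facts falsifies every atom, which excludes the tautological forms of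
  -- redundancy.
  refine h.exists_subset ⟨id, ∅⟩ fun L hL => ?_
  obtain ⟨A, rfl⟩ := hC L hL
  simp [LocalInterp.holds_lit]

/-- A term that may be used in a context: if the context has no predecessor (`p` fails), then the
term does not contain `y`. -/
def Term.Visible (p : Prop) (t : Term F P₁ P₂) : Prop := p ∨ ¬ t.HasVar .y

def Literal.Visible (p : Prop) (L : Literal F P₁ P₂) : Prop := ∀ t ∈ L.sides, t.Visible p

theorem Literal.visible_mk {p pos : _} {s t : Term F P₁ P₂} :
    Literal.Visible p ⟨pos, s(s, t)⟩ ↔ s.Visible p ∧ t.Visible p := by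
  simp [Literal.Visible]

theorem Literal.visible_lit {p : Prop} {A : Atom F P₁ P₂} :
    Literal.Visible p A.lit ↔ (Term.atom A).Visible p := by
  simp [Atom.lit, Literal.eq, Literal.visible_mk, Term.Visible, Term.HasVar]

/-- The three shapes of a context literal. -/
theorem IsContextLiteral.cases_max [LinearOrder F] {L : Literal F P₁ P₂} (h : IsContextLiteral L) :
    (∃ A, IsContextPTerm A ∧ L = A.lit) ∨
    (∃ (pos : Bool) (t : FTerm F), (t = .y ∨ ∃ f, t = .fx f) ∧
      L = ⟨pos, s(.fterm t, .fterm t)⟩) ∨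
    (∃ (pos : Bool) (f : F) (t : FTerm F), (t = .y ∨ ∃ g < f, t = .fx g) ∧
      L = ⟨pos, s(.fterm (.fx f), .fterm t)⟩) := by
  cases h with
  | atom hA => exact .inl ⟨_, hA, rfl⟩
  | ff pos f g =>
    rcases lt_trichotomy f g with h | rfl | h
    · exact .inr (.inr ⟨pos, g, .fx f, .inr ⟨f, h, rfl⟩, by rw [Sym2.eq_swap]⟩)
    · exact .inr (.inl ⟨pos, _, .inr ⟨f, rfl⟩, rfl⟩)
    · exact .inr (.inr ⟨pos, f, .fx g, .inr ⟨g, h, rfl⟩, rfl⟩)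
  | fy pos f => exact .inr (.inr ⟨pos, f, .y, .inl rfl, rfl⟩)
  | yy pos => exact .inr (.inl ⟨pos, .y, .inl rfl, rfl⟩)

/-- `TOP` and the context terms other than `x`; these are the sides of the context literals other
than `y ≈ y` and `y ≉ y`, where `y` is a side only if there are function symbols. -/
def IsSide (t : Term F P₁ P₂) : Prop :=
  t = .top ∨ IsContextTerm t ∧ t ≠ .fterm .x ∧ (t = .fterm .y → Nonempty F)

theorem IsContextLiteral.isSide {L : Literal F P₁ P₂} (h : IsContextLiteral L)
    (hL : ∀ pos, L ≠ ⟨pos, s(.fterm .y, .fterm .y)⟩) : ∀ t ∈ L.sides, IsSide t := by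
  have hf (f : F) : IsSide (.fterm (.fx f) : Term F P₁ P₂) :=
    .inr ⟨IsContextFTerm.fx f, by simp [FTerm.fx], by simp [FTerm.fx]⟩
  cases h with
  | atom hA =>
    simp only [Atom.lit, Literal.eq, Sym2.mem_iff]
    rintro t (rfl | rfl)
    exacts [.inr ⟨hA, by simp, by simp⟩, .inl rfl]
  | ff pos f g => simp only [Sym2.mem_iff]; rintro t (rfl | rfl) <;> exact hf _
  | fy pos f =>
    simp only [Sym2.mem_iff]
    rintro t (rfl | rfl)
    exacts [hf _, .inr ⟨IsContextFTerm.y, by simp, fun _ => ⟨f⟩⟩]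
  | yy pos => exact absurd rfl (hL pos)

end LocalInterpretations

/-! ### Linear extensions of the term and literal orders -/

section Orders

theorem mulGt.exists_of_count_lt {α : Type u} [inst : DecidableEq α] {gt : α → α → Prop}
    {M N : Multiset α} (h : mulGt gt M N) {n : α} (hn : M.count n < N.count n) :
    ∃ m, N.count m < M.count m ∧ gt m n := by
  obtain rfl : inst = fun a b => Classical.propDecidable (a = b) :=
    Subsingleton.elim _ _
  let _ := Classical.decEq α
  obtain ⟨m, hm, hmn⟩ := h.2 n (Multiset.mem_sub.2 hn)
  exact ⟨m, Multiset.mem_sub.1 hm, hmn⟩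

variable {F P₁ P₂ : Type u}

/-- The sides of a literal in decreasing order, with its sign in between. -/
def Literal.key [LinearOrder (Term F P₁ P₂)] (L : Literal F P₁ P₂) :
    Term F P₁ P₂ ×ₗ Bool ×ₗ Term F P₁ P₂ :=
  toLex (L.sides.sup, toLex (!L.pos, L.sides.inf))

theorem Literal.key_injective [LinearOrder (Term F P₁ P₂)] :
    Function.Injective (Literal.key (F := F) (P₁ := P₁) (P₂ := P₂)) := by
  rintro ⟨pos, s⟩ ⟨pos', s'⟩ h
  have h : s.sup = s'.sup ∧ (!pos) = (!pos') ∧ s.inf = s'.inf := by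
    simpa [Literal.key, Prod.ext_iff] using h
  have h₁ : s = s' := Sym2.inf_eq_inf_and_sup_eq_sup.1 ⟨h.2.2, h.1⟩
  have h₂ : pos = pos' := by simpa using h.2.1
  rw [h₁, h₂]

variable [LinearOrder (Term F P₁ P₂)]

theorem Literal.key_lt_iff {L L' : Literal F P₁ P₂} :
    L.key < L'.key ↔ L.sides.sup < L'.sides.sup ∨ L.sides.sup = L'.sides.sup ∧
      (L.pos = true ∧ L'.pos = false ∨ L.pos = L'.pos ∧ L.sides.inf < L'.sides.inf) := by
  simp [Literal.key, Prod.Lex.toLex_lt_toLex, Bool.lt_iff]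

theorem Literal.le_sup {L : Literal F P₁ P₂} {t : Term F P₁ P₂} (h : t ∈ L.sides) :
    t ≤ L.sides.sup := by
  obtain ⟨pos, s⟩ := L
  induction s with
  | _ a b =>
    rcases Sym2.mem_iff.1 h with rfl | rfl <;> simp

/-- A linear order on terms that extends the order of a context on visible terms and makes the atoms
of `Λ` small. -/
structure IsAdmissible (gt : Term F P₁ P₂ → Term F P₁ P₂ → Prop) (p : Prop)
    (Λ : Set (Atom F P₁ P₂)) : Prop where
  top_lt : ∀ s : Term F P₁ P₂, IsContextTerm s → .top < s
  lt_of_gt : ∀ s t, gt s t → IsSide s → s.Visible p → t.Visible p → t < s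
  low_lt : ∀ A ∈ Λ, ∀ s : Term F P₁ P₂, IsContextTerm s → s ≠ .fterm .x → s ≠ .fterm .y →
    (∀ A' ∈ Λ, s ≠ .atom A') → .atom A < s

variable {gt : Term F P₁ P₂ → Term F P₁ P₂ → Prop} {p : Prop} {Λ : Set (Atom F P₁ P₂)}

theorem IsAdmissible.lt_of_topExt (h : IsAdmissible gt p Λ) {s t : Term F P₁ P₂}
    (hst : topExt gt s t) (hs : IsSide s) (hsp : s.Visible p) (htp : t.Visible p) : t < s := by
  rcases hst with hst | ⟨hst, rfl⟩
  · exact h.lt_of_gt s t hst hs hsp htp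
  · exact h.top_lt s hst

theorem Literal.count_multiset {pos : Bool} {a b t : Term F P₁ P₂} :
    (Literal.multiset ⟨pos, s(a, b)⟩).count t =
      (if pos then 1 else 2) * ((if t = a then 1 else 0) + if t = b then 1 else 0) := by
  have h : (Sym2.toMultiset s(a, b)).count t = (if t = a then 1 else 0) + if t = b then 1 else 0 := by
    change Multiset.count t (a ::ₘ b ::ₘ 0) = _
    simp [Multiset.count_cons, Multiset.count_singleton, add_comm]
  cases pos <;> simp [Literal.multiset, h, two_mul]

/-- On visible literals, the linear order extends the literal order. -/
theorem IsAdmissible.not_litGt (h : IsAdmissible gt p Λ) {L' : Literal F P₁ P₂} {pos : Bool}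
    {a b : Term F P₁ P₂} (hba : b < a) (hlt : L'.key < Literal.key ⟨pos, s(a, b)⟩)
    (hs' : ∀ t ∈ L'.sides, IsSide t) (hL' : L'.Visible p) (hL : Literal.Visible p ⟨pos, s(a, b)⟩) :
    ¬ litGt gt L' ⟨pos, s(a, b)⟩ := by
  have key (m n : Term F P₁ P₂) (hm : m ∈ L'.sides) (hn : n = a ∨ n = b)
      (hmn : topExt gt m n) : n < m :=
    h.lt_of_topExt hmn (hs' m hm) (hL' m hm) (hL n (by simpa using hn))
  intro hd
  rw [Literal.key_lt_iff] at hlt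
  obtain ⟨pos', s'⟩ := L'
  obtain ⟨a', b', hb', rfl⟩ : ∃ a' b', b' ≤ a' ∧ s' = s(a', b') := by
    clear hlt hd key hL' hs'
    induction s' with
    | _ c d =>
      rcases le_total c d with hcd | hcd
      exacts [⟨d, c, hcd, Sym2.eq_swap⟩, ⟨c, d, hcd, rfl⟩]
  simp only [Sym2.sup_mk, Sym2.inf_mk, sup_eq_left.2 hba.le, inf_eq_right.2 hba.le,
    sup_eq_left.2 hb', inf_eq_right.2 hb'] at hlt
  have dom (n : Term F P₁ P₂) (hn : n = a ∨ n = b)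
      (hc : (Literal.multiset ⟨pos', s(a', b')⟩).count n <
        (Literal.multiset ⟨pos, s(a, b)⟩).count n) :
      ∃ m, (Literal.multiset ⟨pos, s(a, b)⟩).count m <
        (Literal.multiset ⟨pos', s(a', b')⟩).count m ∧ (m = a' ∨ m = b') ∧ n < m := by
    obtain ⟨m, hm, hmn⟩ := mulGt.exists_of_count_lt hd hc
    have hm' : m = a' ∨ m = b' := by
      by_contra! hm'
      simp [Literal.count_multiset, hm'] at hm
    exact ⟨m, hm, hm', key m n (by simpa using hm') hn hmn⟩
  simp only [Literal.count_multiset] at dom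
  -- In each case some term is more frequent in the larger literal and would have to be dominated by
  -- a surplus term of `L'`. The cases are a larger maximal side, a negative against a positive
  -- sign, and a larger minimal side; the term is `a`, `a` again (or `b` if `L'` has equal sides),
  -- and `b`. No surplus side of `L'` lies above it.
  rcases hlt with hlt | ⟨rfl, ⟨rfl, rfl⟩ | ⟨rfl, hlt⟩⟩
  · obtain ⟨m, -, hm, hma⟩ := dom a (.inl rfl) (by
      simp only [hlt.ne', (hb'.trans_lt hlt).ne', if_true, if_false]
      cases pos <;> simp)
    rcases hm with rfl | rfl
    · exact absurd hma hlt.not_gt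
    · exact absurd hma (hb'.trans_lt hlt).not_gt
  · rcases hb'.eq_or_lt with rfl | hb''
    · obtain ⟨m, hm, hm', -⟩ := dom b (.inr rfl) (by simp [hba.ne])
      have : m = b' := by simpa using hm'
      subst this
      simp [hba.ne'] at hm
    · obtain ⟨m, hm, rfl | rfl, hma⟩ := dom a' (.inl rfl) (by simp [hb''.ne', hba.ne'])
      · exact lt_irrefl _ hma
      · exact absurd hma hb''.not_gt
  · have hb'' := hlt.trans hba
    obtain ⟨m, hm, rfl | rfl, hma⟩ := dom b (.inr rfl) (by
      simp only [hba.ne, hlt.ne', if_true, if_false]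
      cases pos' <;> simp)
    · simp [hba.ne', hb''.ne'] at hm
    · exact absurd hma hlt.not_gt

end Orders

section Orders

variable {F P₁ P₂ : Type u}

/-- A function symbol is needed because `x ≻ y` is only imposed together with some `f(x) ≻ x`.
Without one, `y` may sit anywhere, which is why `IsSide` and `Active` exclude it then. -/
theorem IsContextTermOrder.gt_y [LinearOrder F] {O : Ontology F P₁ P₂}
    {gt : Term F P₁ P₂ → Term F P₁ P₂ → Prop} (h : IsContextTermOrder O gt) [hF : Nonempty F]
    {t : Term F P₁ P₂} (ht : IsContextTerm t) (hty : t ≠ .fterm .y) : gt t (.fterm .y) := by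
  obtain ⟨f₀⟩ := hF
  have hx := (h.fxy f₀).2
  have via (hs : (Term.fterm .x : Term F P₁ P₂).IsSubterm t) (hne : .fterm .x ≠ t) :
      gt t (.fterm .y) := h.trans _ _ _ (h.subterm t _ ht hs hne) hx
  cases t with
  | top => exact ht.elim
  | fterm t =>
    cases ht with
    | x => exact hx
    | y => exact absurd rfl hty
    | fx f => exact h.trans _ _ _ (h.fxy f).1 hx
  | atom A =>
    have ht' := ht
    rcases ht with ⟨⟨⟩⟩ | _ | _ | _
    · exact h.subterm _ _ ht' (by simp [Term.IsSubterm, FTerm.IsSubterm]) (by simp)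
    all_goals exact via (by simp [Term.IsSubterm, FTerm.IsSubterm]) (by simp)

theorem exists_lex_linearOrder {α : Type u} [inst : LinearOrder α] (c : α → ℕ) :
    ∃ lo : LinearOrder α, ∀ s t, lo.lt s t ↔ c s < c t ∨ c s = c t ∧ inst.lt s t := by
  let k (s : α) : ℕ ×ₗ α := toLex (c s, s)
  have hk : Function.Injective k := fun s t hst => congrArg (fun z => (ofLex z).2) hst
  have h (s t : α) : k s < k t ↔ c s < c t ∨ c s = c t ∧ s < t := Prod.Lex.toLex_lt_toLex
  exact ⟨LinearOrder.lift' k hk, h⟩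

open Classical in
/-- Every context term order has an admissible linear extension. -/
theorem IsContextTermOrder.exists_isAdmissible [LinearOrder F] {O : Ontology F P₁ P₂}
    {gt : Term F P₁ P₂ → Term F P₁ P₂ → Prop} (h : IsContextTermOrder O gt) {p : Prop}
    {Λ : Set (Atom F P₁ P₂)}
    (hΛ : ∀ A ∈ Λ, ∀ s, IsContextTerm s → s ≠ .fterm .x → s ≠ .fterm .y → s.Visible p →
      gt (.atom A) s → ∃ A' ∈ Λ, s = .atom A') :
    ∃ _ : LinearOrder (Term F P₁ P₂), IsAdmissible gt p Λ := by
  -- The reflexive closure of the order with `TOP` added at the bottom; it is first extended to an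
  -- arbitrary linear order.
  let r (s t : Term F P₁ P₂) : Prop := s = t ∨ gt t s ∨ s = .top ∧ IsContextTerm t
  have hr : IsPartialOrder _ r :=
    { refl := fun s => .inl rfl
      trans := by
        rintro a b c (rfl | hab | ⟨rfl, hb⟩) (rfl | hbc | ⟨rfl, hc⟩)
        · exact .inl rfl
        · exact .inr (.inl hbc)
        · exact .inr (.inr ⟨rfl, hc⟩)
        · exact .inr (.inl hab)
        · exact .inr (.inl (h.trans _ _ _ hbc hab))
        · exact (h.field _ _ hab).1.elim
        · exact .inr (.inr ⟨rfl, hb⟩)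
        · exact .inr (.inr ⟨rfl, (h.field _ _ hbc).1⟩)
        · exact hb.elim
      antisymm := by
        rintro a b (rfl | hab | ⟨rfl, hb⟩) (hba | hba | ⟨hba, hc⟩)
        · rfl
        · rfl
        · rfl
        · exact hba.symm
        · exact (h.irrefl _ (h.trans _ _ _ hab hba)).elim
        · subst hba; exact (h.field _ _ hab).1.elim
        · exact hba.symm
        · exact (h.field _ _ hba).1.elim
        · exact hc.elim }
  obtain ⟨le, hle, hrle⟩ := extend_partialOrder r
  let lo : LinearOrder (Term F P₁ P₂) :=
    { le := le
      le_refl := hle.refl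
      le_trans := hle.trans
      le_antisymm := hle.antisymm
      le_total := hle.total
      toDecidableLE := fun _ _ => Classical.propDecidable _ }
  -- The linear order is then refined lexicographically by three layers: `TOP` and the variables,
  -- the atoms of `Λ`, everything else.
  let c (s : Term F P₁ P₂) : ℕ :=
    if s = .top ∨ s = .fterm .x ∨ s = .fterm .y then 0 else if ∃ A ∈ Λ, s = .atom A then 1 else 2
  obtain ⟨lo', hlo⟩ := exists_lex_linearOrder c
  have lt_def (s t : Term F P₁ P₂) (h₁ : c s ≤ c t) (h₂ : r s t) (h₃ : s ≠ t) : lo'.lt s t := by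
    rw [hlo]
    rcases h₁.lt_or_eq with h₁ | h₁
    · exact .inl h₁
    · exact .inr ⟨h₁, lo.lt_iff_le_not_ge _ _ |>.2
        ⟨hrle _ _ h₂, fun h' => h₃ (hle.antisymm _ _ (hrle _ _ h₂) h')⟩⟩
  refine ⟨lo', ?_, ?_, ?_⟩
  · rintro s hs
    refine lt_def _ _ (by simp [c]) (.inr (.inr ⟨rfl, hs⟩)) ?_
    rintro rfl
    exact hs
  · intro s t hst hs hsp htp
    obtain ⟨hsc, htc⟩ := h.field _ _ hst
    refine lt_def _ _ ?_ (.inr (.inl hst)) (by rintro rfl; exact h.irrefl _ hst)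
    rcases hs with rfl | ⟨-, hsx, hsy⟩
    · exact hsc.elim
    have hst' : s ≠ .top := by rintro rfl; exact hsc
    have htt' : t ≠ .top := by rintro rfl; exact htc
    have hsy' : s ≠ .fterm .y := by
      intro e
      have := hsy e
      subst e
      by_cases hty : t = .fterm .y
      · subst hty; exact h.irrefl _ hst
      · exact h.irrefl _ (h.trans _ _ _ hst (h.gt_y htc hty))
    by_cases ht : t = .fterm .x ∨ t = .fterm .y
    · simp [c, ht]
    push Not at ht
    by_cases hsΛ : ∃ A ∈ Λ, s = .atom A
    · obtain ⟨A, hA, rfl⟩ := hsΛ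
      -- This is where downward closure of `Λ` is needed: a visible term below an atom of `Λ` is a
      -- variable or again in `Λ`, so the layers respect the given order.
      have := hΛ A hA t htc ht.1 ht.2 htp hst
      simp [c, this]
      split_ifs <;> simp
    · simp only [c, hst', hsx, hsy', hsΛ, if_false, or_self]
      split_ifs <;> simp
  · intro A hA s hs hsx hsy hsΛ
    refine (hlo _ _).2 ?_
    left
    have hst' : s ≠ .top := by rintro rfl; exact hs
    have : ¬ ∃ A ∈ Λ, s = .atom A := by push Not; exact hsΛ
    simp [c, hst', hsx, hsy, this, hA]

end Orders

/-- Recursion on a linear order in which only the values on a finite set differ from a default. -/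
theorem exists_recursion {α β : Type*} [LinearOrder α] (T : Set α) (hT : T.Finite) (d : α → β)
    (G : α → (α → β) → β) (hG : ∀ a ∉ T, ∀ ρ, G a ρ = d a) :
    ∃ v : α → β, ∀ a, v a = G a (fun b => if b < a then v b else d b) := by
  classical
  let r (b a : α) : Prop := b ∈ T ∧ b < a
  -- The linear order itself need not be well founded. Only predecessors in the finite set `T`
  -- count, and their number strictly decreases along `r`.
  have hr : WellFounded r := by
    refine Subrelation.wf (r := InvImage (· < ·) fun a => (hT.toFinset.filter (· < a)).card) ?_
      (InvImage.wf _ wellFounded_lt)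
    rintro b a ⟨hb, hba⟩
    refine Finset.card_lt_card ⟨fun c hc => ?_, fun hs => ?_⟩
    · simp only [Finset.mem_filter] at hc ⊢
      exact ⟨hc.1, hc.2.trans hba⟩
    · have := hs (Finset.mem_filter.2 ⟨hT.mem_toFinset.2 hb, hba⟩)
      exact lt_irrefl _ (Finset.mem_filter.1 this).2
  let H (a : α) (rec : ∀ b, r b a → β) : β := G a fun b => if h : r b a then rec b h else d b
  refine ⟨hr.fix H, fun a => ?_⟩
  have hd : ∀ b ∉ T, hr.fix H b = d b := fun b hb => by rw [hr.fix_eq]; exact hG b hb _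
  conv_lhs => rw [hr.fix_eq]
  refine congrArg (G a) (funext fun b => ?_)
  by_cases hb : b ∈ T
  · by_cases hba : b < a <;> simp [r, hb, hba]
  · by_cases hba : b < a <;> simp [r, hb, hd]

/-! ### Production of rewrite rules by clauses -/

section Production

variable {F P₁ P₂ : Type u}

theorem visible_fx (p : Prop) (f : F) : (Term.fterm (.fx f) : Term F P₁ P₂).Visible p :=
  .inr (by simp [Term.HasVar, FTerm.HasVar])

section

variable [LinearOrder F]

/-- `t` is a possible right-hand side of a rewrite rule for `f(x)`. -/
def IsLower (p : Prop) (f : F) (t : FTerm F) : Prop := t = .y ∧ p ∨ ∃ g < f, t = .fx g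

theorem visible_lower {p : Prop} {f : F} {t : FTerm F} (ht : IsLower p f t) :
    (Term.fterm t : Term F P₁ P₂).Visible p := by
  rcases ht with ⟨rfl, hp⟩ | ⟨g, -, rfl⟩
  exacts [.inl hp, visible_fx p g]

theorem isLower_of_visible {p : Prop} {f : F} {t : FTerm F} (h : t = .y ∨ ∃ g < f, t = .fx g)
    (ht : (Term.fterm t : Term F P₁ P₂).Visible p) : IsLower p f t := by
  rcases h with rfl | h
  · rcases ht with hp | ht
    · exact .inl ⟨rfl, hp⟩
    · simp [Term.HasVar, FTerm.HasVar] at ht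
  · exact .inr h

end

/-- The value of a term in the interpretation without rewrite rules. -/
def defaultValue : Term F P₁ P₂ → FTerm F ⊕ Prop
  | .fterm t => .inl t
  | .atom _ => .inr False
  | .top => .inr True

/-- The local interpretation given by the values of the left-hand sides of rewrite rules. -/
def interpOf (val : Term F P₁ P₂ → FTerm F ⊕ Prop) : LocalInterp F P₁ P₂ where
  nf t := match val (.fterm t) with
    | .inl s => s
    | .inr _ => t
  facts := {A | val (.atom A) = .inr True}

theorem interpOf_nf_congr {ρ val : Term F P₁ P₂ → FTerm F ⊕ Prop} {t : FTerm F}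
    (ht : ρ (.fterm t) = val (.fterm t)) : (interpOf ρ).nf t = (interpOf val).nf t := by
  simp [interpOf, ht]

variable [LinearOrder (Term F P₁ P₂)]

/-- The values of the terms smaller than `τ`. -/
def below (val : Term F P₁ P₂ → FTerm F ⊕ Prop) (τ : Term F P₁ P₂) :
    Term F P₁ P₂ → FTerm F ⊕ Prop :=
  fun s => if s < τ then val s else defaultValue s

/-- Some clause of `N` produces the rule `τ ⇒ t` on top of the values `ρ`. -/
def Produces (N : Clause F P₁ P₂ → Prop) (ρ : Term F P₁ P₂ → FTerm F ⊕ Prop)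
    (τ t : Term F P₁ P₂) : Prop :=
  t < τ ∧ (∀ A, τ = .atom A → A.mapF (interpOf ρ).nf = A) ∧
    ∃ C, N C ∧ Literal.eq τ t ∈ C.head ∧ ∀ L ∈ C.head, L ≠ .eq τ t →
      L.key < (Literal.eq τ t).key ∧
      ¬ (interpOf (Function.update ρ τ ((interpOf ρ).eval t))).holds L

/-- Only sides of literals in finitely many clauses can be rewritten, so the recursion runs over a
finite set. The least right-hand side is chosen so that rewriting a false `f(x) ≈ t` with the chosen
rule replaces `f(x)` using a smaller equation. -/
theorem exists_values (N : Clause F P₁ P₂ → Prop) (hN : {C | N C}.Finite) :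
    ∃ val : Term F P₁ P₂ → FTerm F ⊕ Prop, ∀ τ,
      (val τ = defaultValue τ ∧ ∀ t, ¬ Produces N (below val τ) τ t) ∨
      ∃ t, val τ = (interpOf (below val τ)).eval t ∧ Produces N (below val τ) τ t ∧
        ∀ t', Produces N (below val τ) τ t' → t ≤ t' := by
  classical
  let T : Set (Term F P₁ P₂) := ⋃ C ∈ {C | N C}, ⋃ L ∈ (C.head : Set (Literal F P₁ P₂)), {t | t ∈ L.sides}
  have hT : T.Finite := by
    refine hN.biUnion fun C _ => C.head.finite_toSet.biUnion fun L _ => ?_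
    refine (L.sides.toMultiset.toFinset.finite_toSet).subset fun t ht => ?_
    simpa using ht
  have memT {ρ τ t} (h : Produces N ρ τ t) : τ ∈ T ∧ t ∈ T := by
    obtain ⟨-, -, C, hC, hL, -⟩ := h
    simp only [T, Set.mem_iUnion]
    exact ⟨⟨C, hC, _, hL, by simp [Literal.eq]⟩, ⟨C, hC, _, hL, by simp [Literal.eq]⟩⟩
  let G (τ : Term F P₁ P₂) (ρ : Term F P₁ P₂ → FTerm F ⊕ Prop) : FTerm F ⊕ Prop :=
    if h : ∃ t, Produces N ρ τ t ∧ ∀ t', Produces N ρ τ t' → t ≤ t' then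
      (interpOf ρ).eval h.choose else defaultValue τ
  obtain ⟨val, hval⟩ := exists_recursion T hT defaultValue G fun τ hτ ρ =>
    dif_neg fun ⟨t, ht, _⟩ => hτ (memT ht).1
  refine ⟨val, fun τ => ?_⟩
  have hτ : val τ = G τ (below val τ) := hval τ
  by_cases h : ∃ t, Produces N (below val τ) τ t ∧ ∀ t', Produces N (below val τ) τ t' → t ≤ t'
  · right
    refine ⟨h.choose, ?_, h.choose_spec.1, h.choose_spec.2⟩
    rw [hτ]
    exact dif_pos h
  · left
    refine ⟨by rw [hτ]; exact dif_neg h, fun t ht => h ?_⟩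
    obtain ⟨m, hm, hmin⟩ := Set.exists_min_image {t | Produces N (below val τ) τ t} id
      (hT.subset fun t ht => (memT ht).2) ⟨t, ht⟩
    exact ⟨m, hm, hmin⟩

theorem below_of_lt {val : Term F P₁ P₂ → FTerm F ⊕ Prop} {s τ : Term F P₁ P₂} (h : s < τ) : below val τ s = val s := if_pos h

variable [LinearOrder F]

/-- The values `val` are those of the rewrite rules produced by the clauses satisfying `N`. -/
structure IsConstruction (O : Ontology F P₁ P₂) (gt : Term F P₁ P₂ → Term F P₁ P₂ → Prop)
    (p : Prop) (Λ : Set (Atom F P₁ P₂)) (N : Clause F P₁ P₂ → Prop)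
    (val : Term F P₁ P₂ → FTerm F ⊕ Prop) : Prop where
  adm : IsAdmissible gt p Λ
  ord : IsContextTermOrder O gt
  ctx : ∀ C, N C → ∀ L ∈ C.head, IsContextLiteral L ∧ L.Visible p ∧
    ∀ pos, L ≠ ⟨pos, s(.fterm .y, .fterm .y)⟩
  cases : ∀ τ, (val τ = defaultValue τ ∧ ∀ t, ¬ Produces N (below val τ) τ t) ∨
      ∃ t, val τ = (interpOf (below val τ)).eval t ∧ Produces N (below val τ) τ t ∧
        ∀ t', Produces N (below val τ) τ t' → t ≤ t'

namespace IsConstruction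

variable {O : Ontology F P₁ P₂} {gt : Term F P₁ P₂ → Term F P₁ P₂ → Prop} {p : Prop}
  {Λ : Set (Atom F P₁ P₂)} {N : Clause F P₁ P₂ → Prop} {val : Term F P₁ P₂ → FTerm F ⊕ Prop}

theorem gt_lower (h : IsConstruction O gt p Λ N val) {f : F} {t : FTerm F} (ht : IsLower p f t) :
    gt (.fterm (.fx f)) (.fterm t) := by
  rcases ht with ⟨rfl, hp⟩ | ⟨g, hg, rfl⟩
  exacts [h.ord.trans _ _ _ (h.ord.fxy f).1 (h.ord.fxy f).2, h.ord.fun_gt f g hg]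

theorem lower_lt (h : IsConstruction O gt p Λ N val) {f : F} {t : FTerm F} (ht : IsLower p f t) :
    (Term.fterm t : Term F P₁ P₂) < .fterm (.fx f) :=
  h.adm.lt_of_gt _ _ (h.gt_lower ht)
    (.inr ⟨IsContextFTerm.fx f, by simp [FTerm.fx], by simp [FTerm.fx]⟩)
    (visible_fx p f) (visible_lower ht)

/-- The condition `t < τ` forces the orientation of a context equation, so variables and `TOP` are
never rewritten. -/
theorem rule_cases (h : IsConstruction O gt p Λ N val) {ρ : Term F P₁ P₂ → FTerm F ⊕ Prop}
    {τ t : Term F P₁ P₂} (hp : Produces N ρ τ t) :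
    (∃ A, IsContextPTerm A ∧ (Term.atom A).Visible p ∧ τ = .atom A ∧ t = .top) ∨
    ∃ f t', IsLower p f t' ∧ τ = .fterm (.fx f) ∧ t = .fterm t' := by
  obtain ⟨hlt, -, C, hC, hL, -⟩ := hp
  obtain ⟨hctx, hvis, -⟩ := h.ctx C hC _ hL
  obtain ⟨hτv, htv⟩ := Literal.visible_mk.1 hvis
  rcases hctx.cases_max with ⟨A, hA, e⟩ | ⟨pos, t', -, e⟩ | ⟨pos, f, t', ht', e⟩
  · simp only [Literal.eq, Atom.lit, Literal.mk.injEq, true_and, Sym2.eq_iff] at e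
    rcases e with ⟨rfl, rfl⟩ | ⟨rfl, rfl⟩
    · exact .inl ⟨A, hA, hτv, rfl, rfl⟩
    · exact absurd hlt (h.adm.top_lt (.atom A) hA).not_gt
  · simp only [Literal.eq, Literal.mk.injEq, Sym2.eq_iff] at e
    rcases e with ⟨-, ⟨rfl, rfl⟩ | ⟨rfl, rfl⟩⟩ <;> exact absurd hlt (lt_irrefl _)
  · simp only [Literal.eq, Literal.mk.injEq, Sym2.eq_iff] at e
    rcases e with ⟨-, ⟨rfl, rfl⟩ | ⟨rfl, rfl⟩⟩
    · exact .inr ⟨f, t', isLower_of_visible ht' htv, rfl, rfl⟩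
    · exact absurd hlt (h.lower_lt (isLower_of_visible ht' hτv)).not_gt

theorem val_var (h : IsConstruction O gt p Λ N val) (v : Var) :
    val (.fterm (.var v)) = .inl (.var v) := by
  rcases h.cases (.fterm (.var v)) with ⟨hv, -⟩ | ⟨t, -, ht, -⟩
  · exact hv
  · rcases h.rule_cases ht with ⟨A, -, -, e, -⟩ | ⟨f, t', -, e, -⟩ <;> simp [FTerm.fx] at e

theorem nf_var (h : IsConstruction O gt p Λ N val) (v : Var) :
    (interpOf val).nf (.var v) = .var v := by
  simp [interpOf, h.val_var]

/-- Either `f(x)` is in normal form, or it is rewritten by a produced rule. -/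
theorem nf_fx (h : IsConstruction O gt p Λ N val) (f : F) :
    ((interpOf val).nf (.fx f) = .fx f ∧
      ∀ t, ¬ Produces N (below val (.fterm (.fx f))) (.fterm (.fx f)) t) ∨
    ∃ t, IsLower p f t ∧ (interpOf val).nf (.fx f) = (interpOf val).nf t ∧
      val (.fterm (.fx f)) = (interpOf (below val (.fterm (.fx f)))).eval (.fterm t) ∧
      Produces N (below val (.fterm (.fx f))) (.fterm (.fx f)) (.fterm t) ∧
      ∀ t', Produces N (below val (.fterm (.fx f))) (.fterm (.fx f)) t' → .fterm t ≤ t' := by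
  rcases h.cases (.fterm (.fx f)) with ⟨hv, hn⟩ | ⟨t, hv, ht, hmin⟩
  · left
    refine ⟨?_, hn⟩
    simp only [defaultValue] at hv
    simp [interpOf, hv]
  · right
    rcases h.rule_cases ht with ⟨A, -, -, e, -⟩ | ⟨f', t', hl, e, rfl⟩
    · simp at e
    · obtain rfl : f = f' := by simpa [FTerm.fx] using e
      refine ⟨t', hl, ?_, hv, ht, hmin⟩
      have : val (.fterm (.fx f)) = .inl ((interpOf val).nf t') := by
        rw [hv, LocalInterp.eval, interpOf_nf_congr (below_of_lt (h.lower_lt hl))]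
      simp [interpOf, this]

/-- Replacing `f(x)` by a smaller term in a context atom. -/
theorem replace_cases (h : IsConstruction O gt p Λ N val) {A : Atom F P₁ P₂}
    (hA : IsContextPTerm A) (hAv : (Term.atom A).Visible p) :
    A.mapF (interpOf val).nf = A ∨ ∃ f, (interpOf val).nf (.fx f) ≠ .fx f ∧
      (Term.fterm (.fx f) : Term F P₁ P₂) < .atom A ∧
      ∀ t, IsLower p f t → ∃ A' : Atom F P₁ P₂,
        Term.Replace (.fterm (.fx f)) (.fterm t) (.atom A : Term F P₁ P₂) (.atom A') ∧
        (Term.atom A').Visible p ∧ (Term.atom A' : Term F P₁ P₂) < .atom A ∧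
        ((interpOf val).nf (.fx f) = (interpOf val).nf t →
          A'.mapF (interpOf val).nf = A.mapF (interpOf val).nf) ∧
        ((interpOf val).nf (.fx f) = t → A.mapF (interpOf val).nf = A') := by
  have hx := h.nf_var .x
  have hy := h.nf_var .y
  have sub (f : F) (hs : (Term.fterm (.fx f)).IsSubterm (.atom A : Term F P₁ P₂)) :
      (Term.fterm (.fx f) : Term F P₁ P₂) < .atom A :=
    h.adm.lt_of_gt _ _ (h.ord.subterm _ _ hA hs (by simp)) (.inr ⟨hA, by simp, by simp⟩) hAv
      (visible_fx p f)
  have rep (f : F) (t : FTerm F) (A' : Atom F P₁ P₂) (ht : IsLower p f t)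
      (hr : Term.Replace (.fterm (.fx f)) (.fterm t) (.atom A : Term F P₁ P₂) (.atom A'))
      (hA' : IsContextPTerm A') (hAv' : (Term.atom A').Visible p) :
      (Term.atom A' : Term F P₁ P₂) < .atom A :=
    h.adm.lt_of_gt _ _ (h.ord.mono _ _ _ _ (h.gt_lower ht) hr hA hA')
      (.inr ⟨hA, by simp, by simp⟩) hAv hAv'
  rcases hA with ⟨⟨⟩⟩ | ⟨B, f⟩ | ⟨S, f⟩ | ⟨S, f⟩
  · left; simp [Atom.mapF, hy]
  · left; simp [Atom.mapF, hx]
  · left; simp [Atom.mapF, hx, hy]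
  · left; simp [Atom.mapF, hx, hy]
  · by_cases hf : (interpOf val).nf (.fx f) = .fx f
    · left; simp [Atom.mapF, hf]
    refine .inr ⟨f, hf, sub f (by simp [Term.IsSubterm, FTerm.IsSubterm, FTerm.fx]),
      fun t ht => ⟨.un B t, ?_⟩⟩
    have hr : Term.Replace (.fterm (.fx f)) (.fterm t) (.atom (.un B (.fx f)) : Term F P₁ P₂)
      (.atom (.un B t)) := .un B .root
    have hv : (Term.atom (.un B t) : Term F P₁ P₂).Visible p :=
      (visible_lower ht : (Term.fterm t : Term F P₁ P₂).Visible p)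
    refine ⟨hr, hv, rep f t _ ht hr ?_ hv, fun e => by simp [Atom.mapF, e],
      fun e => by simp [Atom.mapF, e]⟩
    rcases ht with ⟨rfl, -⟩ | ⟨g, -, rfl⟩
    exacts [.free (.By B), .Bf B g]
  · by_cases hf : (interpOf val).nf (.fx f) = .fx f
    · left; simp [Atom.mapF, hf, hx]
    refine .inr ⟨f, hf, sub f (by simp [Term.IsSubterm, FTerm.IsSubterm, FTerm.fx]),
      fun t ht => ⟨.bin S .x t, ?_⟩⟩
    have hr : Term.Replace (.fterm (.fx f)) (.fterm t) (.atom (.bin S .x (.fx f)) : Term F P₁ P₂)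
      (.atom (.bin S .x t)) := .binRight S _ .root
    have hv : (Term.atom (.bin S .x t) : Term F P₁ P₂).Visible p := by
      simpa [Term.Visible, Term.HasVar, Atom.HasVar, FTerm.HasVar] using
        (visible_lower ht : (Term.fterm t : Term F P₁ P₂).Visible p)
    refine ⟨hr, hv, rep f t _ ht hr ?_ hv, fun e => by simp [Atom.mapF, e],
      fun e => by simp [Atom.mapF, e, hx]⟩
    rcases ht with ⟨rfl, -⟩ | ⟨g, -, rfl⟩
    exacts [.free (.Sxy S), .Sxf S g]
  · by_cases hf : (interpOf val).nf (.fx f) = .fx f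
    · left; simp [Atom.mapF, hf, hx]
    refine .inr ⟨f, hf, sub f (by simp [Term.IsSubterm, FTerm.IsSubterm, FTerm.fx]),
      fun t ht => ⟨.bin S t .x, ?_⟩⟩
    have hr : Term.Replace (.fterm (.fx f)) (.fterm t) (.atom (.bin S (.fx f) .x) : Term F P₁ P₂)
      (.atom (.bin S t .x)) := .binLeft S _ .root
    have hv : (Term.atom (.bin S t .x) : Term F P₁ P₂).Visible p := by
      simpa [Term.Visible, Term.HasVar, Atom.HasVar, FTerm.HasVar] using
        (visible_lower ht : (Term.fterm t : Term F P₁ P₂).Visible p)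
    refine ⟨hr, hv, rep f t _ ht hr ?_ hv, fun e => by simp [Atom.mapF, e],
      fun e => by simp [Atom.mapF, e, hx]⟩
    rcases ht with ⟨rfl, -⟩ | ⟨g, -, rfl⟩
    exacts [.free (.Syx S), .Sfx S g]

theorem mapF_congr (h : IsConstruction O gt p Λ N val) {ρ : Term F P₁ P₂ → FTerm F ⊕ Prop}
    {A : Atom F P₁ P₂} (hA : IsContextPTerm A) (hAv : (Term.atom A).Visible p)
    (hρ : ∀ s < .atom A, ρ s = val s)
    (hvar : ∀ v, ρ (.fterm (.var v)) = val (.fterm (.var v))) :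
    A.mapF (interpOf ρ).nf = A.mapF (interpOf val).nf := by
  have hx := interpOf_nf_congr (hvar .x)
  have hy := interpOf_nf_congr (hvar .y)
  have hf (f : F) (hs : (Term.fterm (.fx f)).IsSubterm (.atom A : Term F P₁ P₂)) :
      (interpOf ρ).nf (.fx f) = (interpOf val).nf (.fx f) :=
    interpOf_nf_congr (hρ _ (h.adm.lt_of_gt (.atom A) _ (h.ord.subterm _ _ hA hs (by simp))
      (.inr ⟨hA, by simp, by simp⟩) hAv (visible_fx p f)))
  rcases hA with ⟨⟨⟩⟩ | _ | _ | _ <;> simp [Atom.mapF, hx, hy]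
  all_goals exact hf _ (by simp [Term.IsSubterm, FTerm.IsSubterm, FTerm.fx])

theorem below_var (h : IsConstruction O gt p Λ N val) (τ : Term F P₁ P₂) (v : Var) :
    below val τ (.fterm (.var v)) = val (.fterm (.var v)) := by
  rw [below, h.val_var]
  split_ifs <;> rfl

variable [WellFoundedLT F]

/-- A rule leads from `f(x)` to `y` or to some `g(x)` with `g` smaller, so rewriting terminates by
well-foundedness of the order on function symbols. -/
theorem nf_app (h : IsConstruction O gt p Λ N val) (f : F) :
    (interpOf val).nf (.fx f) = .y ∧ p ∨
      ∃ g ≤ f, (interpOf val).nf (.fx f) = .fx g ∧ (interpOf val).nf (.fx g) = .fx g := by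
  induction f using WellFoundedLT.induction with
  | _ f ih =>
    rcases h.nf_fx f with ⟨hf, -⟩ | ⟨t, hl, hf, -⟩
    · exact .inr ⟨f, le_rfl, hf, hf⟩
    · rw [hf]
      rcases hl with ⟨rfl, hp⟩ | ⟨g, hg, rfl⟩
      · exact .inl ⟨h.nf_var _, hp⟩
      · rcases ih g hg with h' | ⟨g', hg', h'⟩
        exacts [.inl h', .inr ⟨g', hg'.trans hg.le, h'⟩]

/-- The normal form of `f(x)` is `f(x)` or a possible right-hand side. -/
theorem nf_lower (h : IsConstruction O gt p Λ N val) (f : F) :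
    (interpOf val).nf (.fx f) = .fx f ∨ IsLower p f ((interpOf val).nf (.fx f)) := by
  rcases h.nf_app f with h' | ⟨g, hg, h', -⟩
  · exact .inr (.inl h')
  · rcases hg.lt_or_eq with hg | rfl
    exacts [.inr (.inr ⟨g, hg, h'⟩), .inl h']

/-- The value of a term depends only on the values of the terms that are not larger. -/
theorem eval_congr (h : IsConstruction O gt p Λ N val) {ρ : Term F P₁ P₂ → FTerm F ⊕ Prop}
    {s : Term F P₁ P₂} (hs : IsSide s) (hsv : s.Visible p) (hρ : ∀ s' ≤ s, ρ s' = val s')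
    (hvar : ∀ v, ρ (.fterm (.var v)) = val (.fterm (.var v))) :
    (interpOf ρ).eval s = (interpOf val).eval s := by
  cases s with
  | top => rfl
  | fterm t => simp [LocalInterp.eval, interpOf_nf_congr (hρ _ le_rfl)]
  | atom A =>
    obtain ⟨hA, -⟩ : IsContextPTerm A ∧ _ := hs.resolve_left (by simp)
    have hmap := h.mapF_congr hA hsv (fun s hs => hρ s hs.le) hvar
    -- The truth of an atom is looked up at its normal form, which is not larger than the atom;
    -- hence no value above `s` is consulted.
    have hle : (Term.atom (A.mapF (interpOf val).nf) : Term F P₁ P₂) ≤ .atom A := by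
      rcases h.replace_cases hA hsv with e | ⟨f, hf, -, hrep⟩
      · rw [e]
      · obtain ⟨A', -, -, hlt, -, he⟩ := hrep _ ((h.nf_lower f).resolve_left hf)
        rw [he rfl]
        exact hlt.le
    simp only [LocalInterp.eval, hmap]
    exact congrArg Sum.inr (congrArg (· = Sum.inr True) (hρ _ hle))

/-- Rules added later concern terms above `τ`. The values seen by a clause at the moment of
production are therefore the final ones. -/
theorem eval_update_below (h : IsConstruction O gt p Λ N val) {s τ : Term F P₁ P₂} (hs : IsSide s)
    (hsv : s.Visible p) (hτ : ∀ v, τ ≠ .fterm (.var v)) (hle : s ≤ τ) {w : FTerm F ⊕ Prop}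
    (hw : s = τ → w = val τ) :
    (interpOf (Function.update (below val τ) τ w)).eval s = (interpOf val).eval s := by
  have hvar (v : Var) : Function.update (below val τ) τ w (.fterm (.var v)) =
      val (.fterm (.var v)) := by
    rw [Function.update_of_ne (hτ v).symm, h.below_var]
  refine h.eval_congr hs hsv (fun s' hs' => ?_) hvar
  rcases (hs'.trans hle).lt_or_eq with hlt | rfl
  · rw [Function.update_of_ne hlt.ne, below_of_lt hlt]
  · rw [Function.update_self, hw (le_antisymm hle hs')]

/-- The other literals of a producing clause fail. -/
theorem exists_producer (h : IsConstruction O gt p Λ N val) {τ t : Term F P₁ P₂}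
    (hp : Produces N (below val τ) τ t) (hv : val τ = (interpOf (below val τ)).eval t) :
    ∃ C, N C ∧ Literal.eq τ t ∈ C.head ∧ ∀ L ∈ C.head, L ≠ .eq τ t →
      L.key < (Literal.eq τ t).key ∧ ¬ (interpOf val).holds L := by
  have hτ : ∀ v, τ ≠ .fterm (.var v) := by
    rintro v rfl
    rcases h.rule_cases hp with ⟨A, -, -, e, -⟩ | ⟨f, t', -, e, -⟩ <;> simp [FTerm.fx] at e
  obtain ⟨hlt, -, C, hC, hL, hother⟩ := hp
  refine ⟨C, hC, hL, fun L hLC hne => ⟨(hother L hLC hne).1, fun hL' => (hother L hLC hne).2 ?_⟩⟩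
  obtain ⟨hctx, hvis, hy⟩ := h.ctx C hC L hLC
  refine (LocalInterp.holds_congr fun s hs => ?_).2 hL'
  rw [← hv]
  refine h.eval_update_below (hctx.isSide hy s hs) (hvis s hs) hτ ?_ fun _ => rfl
  refine (Literal.le_sup hs).trans ?_
  have := (hother L hLC hne).1
  rw [Literal.key_lt_iff] at this
  simp only [Literal.eq, Sym2.sup_mk, sup_eq_left.2 hlt.le] at this
  rcases this with h' | h'
  exacts [h'.le, h'.1.le]

/-- The rewrite rule of a reducible term `f(x)`. -/
theorem exists_producer_fx (h : IsConstruction O gt p Λ N val) {f : F}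
    (hf : (interpOf val).nf (.fx f) ≠ .fx f) :
    ∃ t, IsLower p f t ∧ (interpOf val).nf (.fx f) = (interpOf val).nf t ∧
      (∀ t', Produces N (below val (.fterm (.fx f))) (.fterm (.fx f)) t' → .fterm t ≤ t') ∧
      ∃ C, N C ∧ Literal.eq (.fterm (.fx f)) (.fterm t) ∈ C.head ∧
        ∀ L ∈ C.head, L ≠ .eq (.fterm (.fx f)) (.fterm t) →
          L.key < (Literal.eq (.fterm (.fx f)) (.fterm t)).key ∧ ¬ (interpOf val).holds L := by
  rcases h.nf_fx f with ⟨hf', -⟩ | ⟨t, hl, hnf, hv, hp, hmin⟩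
  · exact absurd hf' hf
  · exact ⟨t, hl, hnf, hmin, h.exists_producer hp hv⟩

/-- A true atom in normal form is produced by a clause. -/
theorem exists_producer_atom (h : IsConstruction O gt p Λ N val) {A : Atom F P₁ P₂}
    (hA : A ∈ (interpOf val).facts) :
    IsContextPTerm A ∧ (Term.atom A).Visible p ∧ A.mapF (interpOf val).nf = A ∧
      ∃ C, N C ∧ A.lit ∈ C.head ∧ ∀ L ∈ C.head, L ≠ A.lit →
        L.key < A.lit.key ∧ ¬ (interpOf val).holds L := by
  rcases h.cases (.atom A) with ⟨hv, -⟩ | ⟨t, hv, hp, -⟩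
  · have hA : val (.atom A) = .inr True := hA
    simp [hv, defaultValue] at hA
  · rcases h.rule_cases hp with ⟨A', hctx, hvis, e, rfl⟩ | ⟨f, t', -, e, -⟩
    · obtain rfl : A = A' := by simpa using e
      refine ⟨hctx, hvis, ?_, h.exists_producer hp hv⟩
      rw [← h.mapF_congr hctx hvis (fun s => below_of_lt) (h.below_var _)]
      exact hp.2.1 A rfl
    · simp at e

end IsConstruction

end Production

/-! ### Comparison of clause heads -/

section

variable {F P₁ P₂ : Type u}

/-- The embedding of literals into their keys. -/
def keyEmb [LinearOrder (Term F P₁ P₂)] :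
    Literal F P₁ P₂ ↪ Term F P₁ P₂ ×ₗ Bool ×ₗ Term F P₁ P₂ :=
  ⟨Literal.key, Literal.key_injective⟩

/-- Trading one literal for strictly smaller ones decreases the head colexicographically. This is
the measure for every reduction to a smaller false clause. -/
theorem colex_lt_of_pivot [LinearOrder (Term F P₁ P₂)] {Δ Δ' : Finset (Literal F P₁ P₂)}
    {L : Literal F P₁ P₂} (hL : L ∈ Δ) (h : ∀ L' ∈ Δ', L' ∈ Δ ∧ L' ≠ L ∨ L'.key < L.key) :
    toColex (Δ'.map keyEmb) < toColex (Δ.map keyEmb) := by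
  have hL' : keyEmb L ∉ Δ'.map keyEmb := by
    rw [Finset.mem_map' keyEmb]
    intro hL'
    rcases h L hL' with h | h
    exacts [h.2 rfl, lt_irrefl _ h]
  have hL : keyEmb L ∈ Δ.map keyEmb := (Finset.mem_map' keyEmb).2 hL
  refine Finset.Colex.toColex_lt_toColex.2 ⟨fun e => hL' (e ▸ hL), fun a ha ha' => ?_⟩
  obtain ⟨L', hL'', rfl⟩ := Finset.mem_map.1 ha
  refine ⟨keyEmb L, hL, hL', ?_⟩
  rcases h L' hL'' with h | h
  · exact absurd ((Finset.mem_map' keyEmb).2 h.1) ha'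
  · exact h.le

theorem IsContextLiteral.eq_lit {L : Literal F P₁ P₂} (h : IsContextLiteral L) {A : Atom F P₁ P₂}
    (hA : .atom A ∈ L.sides) : L = A.lit := by
  cases h with
  | atom _ => simp_all [Atom.lit, Literal.eq]
  | _ => simp at hA

end

/-! ### Saturation, refutable pairs and local models -/

namespace ContextStructure

variable {F P₁ P₂ : Type u} [LinearOrder F] {O : Ontology F P₁ P₂} {V : Type*}
  {D : ContextStructure O V}

theorem Saturated.core (hD : D.Saturated) {v : V} {A : Atom F P₁ P₂} (hA : A ∈ D.core v) :
    (⟨∅, {A.lit}⟩ : Clause F P₁ P₂) ∈ D.S v := by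
  by_contra h
  exact hD (.inl ⟨v, A, hA, h⟩)

open Classical in
theorem Saturated.hyper (hD : D.Saturated) {v : V} {C : Clause F P₁ P₂} (hC : C ∈ O.clauses)
    {σ : Var → FTerm F} (hσ : σ .x = .x) {Γ : Atom F P₁ P₂ → Finset (Atom F P₁ P₂)}
    {Δ : Atom F P₁ P₂ → Finset (Literal F P₁ P₂)}
    (h : ∀ A ∈ C.body, D.MaximalIn v (Γ A) (Δ A) (A.subst σ).lit) :
    D.Has v ⟨C.body.biUnion Γ, C.head.image (Literal.subst σ) ∪ C.body.biUnion Δ⟩ := by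
  by_contra h'
  exact hD (.inr (.inl ⟨v, C, hC, σ, hσ, Γ, Δ, h, h'⟩))

open Classical in
theorem Saturated.eq (hD : D.Saturated) {v : V} {Γ₁ Γ₂ : Finset (Atom F P₁ P₂)}
    {Δ₁ Δ₂ : Finset (Literal F P₁ P₂)} {s₁ t₁ s₂ t₂ w : Term F P₁ P₂} {pos : Bool}
    (h₁ : D.MaximalIn v Γ₁ Δ₁ (.eq s₁ t₁)) (h₁' : topExt (D.gt v) s₁ t₁)
    (h₂ : D.MaximalIn v Γ₂ Δ₂ ⟨pos, s(s₂, t₂)⟩) (h₂' : topExt (D.gt v) s₂ t₂)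
    (hr : Term.Replace s₁ t₁ s₂ w) :
    D.Has v ⟨Γ₁ ∪ Γ₂, Δ₁ ∪ Δ₂ ∪ {⟨pos, s(w, t₂)⟩}⟩ := by
  by_contra h'
  exact hD (.inr (.inr (.inl
    ⟨v, Γ₁, Γ₂, Δ₁, Δ₂, s₁, t₁, s₂, t₂, w, pos, h₁, h₁', h₂, h₂', hr, h'⟩)))

open Classical in
theorem Saturated.ineq (hD : D.Saturated) {v : V} {Γ : Finset (Atom F P₁ P₂)}
    {Δ : Finset (Literal F P₁ P₂)} {t : Term F P₁ P₂}
    (h : ⟨Γ, insert (.ne t t) Δ⟩ ∈ D.S v) : D.Has v ⟨Γ, Δ⟩ := by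
  by_contra h'
  exact hD (.inr (.inr (.inr (.inl ⟨v, Γ, Δ, t, h, h'⟩))))

open Classical in
theorem Saturated.factor (hD : D.Saturated) {v : V} {Γ : Finset (Atom F P₁ P₂)}
    {Δ : Finset (Literal F P₁ P₂)} {s t t' : Term F P₁ P₂}
    (h : D.MaximalIn v Γ (insert (.eq s t) Δ) (.eq s t')) (hst : topExt (D.gt v) s t') :
    D.Has v ⟨Γ, Δ ∪ {.ne t t', .eq s t'}⟩ := by
  by_contra h'
  exact hD (.inr (.inr (.inr (.inr (.inl ⟨v, Γ, Δ, s, t, t', h, hst, h'⟩)))))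

open Classical in
theorem Saturated.pred (hD : D.Saturated) {u v : V} {f : F} (hE : (u, v, f) ∈ D.E)
    {C : Clause F P₁ P₂} (hC : C ∈ D.S v) (hhead : ∀ L ∈ C.head, ∃ A ∈ Pr O, L = A.lit)
    {Γ : Atom F P₁ P₂ → Finset (Atom F P₁ P₂)} {Δ : Atom F P₁ P₂ → Finset (Literal F P₁ P₂)}
    (h : ∀ A ∈ C.body, D.MaximalIn u (Γ A) (Δ A) (A.subst (succSubst f)).lit) :
    D.Has u ⟨C.body.biUnion Γ,
      C.body.biUnion Δ ∪ C.head.image (Literal.subst (succSubst f))⟩ := by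
  by_contra h'
  exact hD (.inr (.inr (.inr (.inr (.inr (.inr (.inl
    ⟨u, v, f, hE, C, hC, hhead, Γ, Δ, h, h'⟩)))))))

theorem Saturated.succ (hD : D.Saturated) {u : V} {f : F} {Γ : Finset (Atom F P₁ P₂)}
    {Δ : Finset (Literal F P₁ P₂)} {A : Atom F P₁ P₂} (h : D.MaximalIn u Γ Δ A.lit)
    (hf : (Term.fterm (.fx f)).IsSubterm (.atom A : Term F P₁ P₂)) :
    ∃ v, (u, v, f) ∈ D.E ∧ ∀ A' ∈ D.K₂ u f, A' ∉ D.core v → D.Has v ⟨{A'}, {A'.lit}⟩ := by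
  by_contra h'
  exact hD (.inr (.inr (.inr (.inr (.inr (.inr (.inr ⟨u, f, Γ, Δ, A, h, hf, h'⟩)))))))

/-- The clauses of `S(v)` that apply when the atoms of `Γ` are true. -/
def Relevant (D : ContextStructure O V) (v : V) (p : Prop) (Γ : Set (Atom F P₁ P₂))
    (C : Clause F P₁ P₂) : Prop :=
  C ∈ D.S v ∧ (C.body : Set (Atom F P₁ P₂)) ⊆ Γ ∧ ∀ L ∈ C.head, L.Visible p

/-- The relevant clauses without `y ≈ y` and `y ≉ y`. -/
def Active (D : ContextStructure O V) (v : V) (p : Prop) (Γ : Set (Atom F P₁ P₂))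
    (C : Clause F P₁ P₂) : Prop :=
  D.Relevant v p Γ C ∧ ∀ pos, (⟨pos, s(.fterm .y, .fterm .y)⟩ : Literal F P₁ P₂) ∉ C.head

/-- `Γ → ⋁ Λ` is not derived in `S(v)`, and the atoms of `Λ` are small in the order of `v`. -/
structure Refutable (D : ContextStructure O V) (v : V) (p : Prop)
    (Γ Λ : Set (Atom F P₁ P₂)) : Prop where
  not_derived : ∀ C ∈ D.S v, (C.body : Set (Atom F P₁ P₂)) ⊆ Γ →
    ¬ ∀ L ∈ C.head, ∃ A ∈ Λ, L = A.lit
  derives : ∀ A ∈ Γ, ∃ C ∈ D.S v, (C.body : Set (Atom F P₁ P₂)) ⊆ Γ ∧ C.head ⊆ {A.lit}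
  visible : ∀ A ∈ Γ, (Term.atom A).Visible p
  free : ∀ A ∈ Λ, IsFunctionFreeContextPTerm A
  low : ∀ A ∈ Λ, ∀ s, IsContextTerm s → s ≠ .fterm .x → s ≠ .fterm .y → s.Visible p →
    D.gt v (.atom A) s → ∃ A' ∈ Λ, s = .atom A'

/-- `J` is a local model of `S(v)` in which `Γ` holds and `Λ` fails, and whose facts are produced by
clauses of `S(v)`. -/
structure IsLocalModel (D : ContextStructure O V) (v : V) (p : Prop)
    (Γ Λ : Set (Atom F P₁ P₂)) (J : LocalInterp F P₁ P₂) : Prop where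
  nf_var : ∀ w : Var, J.nf (.var w) = .var w
  nf_fx : ∀ f : F, J.nf (.fx f) = .y ∧ p ∨
    ∃ g : F, J.nf (.fx f) = .fx g ∧ J.nf (.fx g) = .fx g
  fact_context : ∀ A ∈ J.facts, IsContextPTerm A
  fact_visible : ∀ A ∈ J.facts, (Term.atom A).Visible p
  fact_normal : ∀ A ∈ J.facts, A.mapF J.nf = A
  fact_maximal : ∀ A ∈ J.facts, ∃ Γ₀ Δ₀, D.MaximalIn v Γ₀ Δ₀ A.lit ∧
    (Γ₀ : Set (Atom F P₁ P₂)) ⊆ Γ ∧ ∀ L ∈ Δ₀, L.Visible p ∧ ¬ J.holds L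
  models : ∀ C, D.Relevant v p Γ C → ∃ L ∈ C.head, J.holds L
  true_body : ∀ A ∈ Γ, A.mapF J.nf ∈ J.facts
  false_head : ∀ A ∈ Λ, A ∉ J.facts

variable {v : V} {p : Prop} {Γ Λ : Set (Atom F P₁ P₂)}

/-- A false conclusion of a rule is not tautological, so it is subsumed by a clause of `S(v)`, which
inherits falsity and visibility. The literal `y ≈ y` is true and hence absent, and Ineq removes `y ≉
y`. -/
theorem Saturated.exists_active (hD : D.Saturated) (J : LocalInterp F P₁ P₂)
    {E : Clause F P₁ P₂} (hE : D.Has v E) (hbody : (E.body : Set (Atom F P₁ P₂)) ⊆ Γ)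
    (hvis : ∀ L ∈ E.head, L.Visible p) (hfalse : ∀ L ∈ E.head, ¬ J.holds L) :
    ∃ C, D.Active v p Γ C ∧ C.head ⊆ E.head := by
  classical
  obtain ⟨C, hC, hCb, hCh⟩ := hE.exists_subset J hfalse
  have hfalseC : ∀ L ∈ C.head, ¬ J.holds L := fun L hL => hfalse L (hCh hL)
  have hyy (C : Clause F P₁ P₂) (h : ∀ L ∈ C.head, ¬ J.holds L) :
      (⟨true, s(.fterm .y, .fterm .y)⟩ : Literal F P₁ P₂) ∉ C.head := fun h' =>
    h _ h' ((J.holds_eq _ _).2 rfl)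
  by_cases hy : (Literal.ne (.fterm .y) (.fterm .y) : Literal F P₁ P₂) ∈ C.head
  · have hins : (⟨C.body, insert (.ne (.fterm .y) (.fterm .y)) (C.head.erase
        (.ne (.fterm .y) (.fterm .y)))⟩ : Clause F P₁ P₂) ∈ D.S v := by
      rw [Finset.insert_erase hy]
      exact hC
    obtain ⟨C', hC', hCb', hCh'⟩ := (hD.ineq hins).exists_subset J
      fun L hL => hfalseC L (Finset.mem_of_mem_erase hL)
    have hsub : C'.head ⊆ E.head := (hCh'.trans (Finset.erase_subset _ _)).trans hCh
    refine ⟨C', ⟨⟨hC', ?_, fun L hL => hvis L (hsub hL)⟩, ?_⟩, hsub⟩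
    · exact (Finset.coe_subset.2 (hCb'.trans hCb)).trans hbody
    · rintro (_ | _) h'
      · exact Finset.notMem_erase _ _ (hCh' h')
      · exact hyy C' (fun L hL => hfalse L (hsub hL)) h'
  · refine ⟨C, ⟨⟨hC, (Finset.coe_subset.2 hCb).trans hbody, fun L hL => hvis L (hCh hL)⟩, ?_⟩, hCh⟩
    rintro (_ | _) h'
    · exact hy h'
    · exact hyy C hfalseC h'

section Construction

variable [LinearOrder (Term F P₁ P₂)]
  {val : Term F P₁ P₂ → FTerm F ⊕ Prop}

open Classical in
-- The rules require maximality in the order of the context. Maximality in the linear order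
-- suffices, because that order extends the former on visible literals.
theorem maximalIn_erase (adm : IsAdmissible (D.gt v) p Λ) {C : Clause F P₁ P₂}
    (hC : D.Active v p Γ C) {pos : Bool} {a b : Term F P₁ P₂} (hba : b < a)
    (hL : ⟨pos, s(a, b)⟩ ∈ C.head)
    (hmax : ∀ L ∈ C.head, L ≠ ⟨pos, s(a, b)⟩ → L.key < Literal.key ⟨pos, s(a, b)⟩) :
    D.MaximalIn v C.body (C.head.erase ⟨pos, s(a, b)⟩) ⟨pos, s(a, b)⟩ := by
  refine ⟨by rw [Finset.insert_erase hL]; exact hC.1.1, ?_⟩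
  rintro ⟨L', hL', e | hgt⟩
  · exact Finset.ne_of_mem_erase hL' e
  · have hL'C := Finset.mem_of_mem_erase hL'
    refine adm.not_litGt hba (hmax L' hL'C (Finset.ne_of_mem_erase hL')) ?_ (hC.1.2.2 L' hL'C)
      (hC.1.2.2 _ hL) hgt
    exact ((D.clauses_context v C hC.1.1).head L' hL'C).isSide fun pos e => hC.2 pos (e ▸ hL'C)

/-- Rewriting the maximal literal of a false clause with a produced rule yields a smaller false
clause. -/
theorem exists_smaller_of_rewrite (hD : D.Saturated)
    (h : IsConstruction O (D.gt v) p Λ (D.Active v p Γ) val) {C : Clause F P₁ P₂}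
    (hC : D.Active v p Γ C) (hfalse : ∀ L ∈ C.head, ¬ (interpOf val).holds L)
    {pos : Bool} {s t w : Term F P₁ P₂} (hts : t < s) (hst : topExt (D.gt v) s t)
    (hL : ⟨pos, s(s, t)⟩ ∈ C.head)
    (hmax : ∀ L ∈ C.head, L ≠ ⟨pos, s(s, t)⟩ → L.key < Literal.key ⟨pos, s(s, t)⟩)
    {f : F} {t₁ : FTerm F} (ht₁ : IsLower p f t₁) {C₁ : Clause F P₁ P₂}
    (hC₁ : D.Active v p Γ C₁) (hL₁ : Literal.eq (.fterm (.fx f)) (.fterm t₁) ∈ C₁.head)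
    (hmax₁ : ∀ L ∈ C₁.head, L ≠ .eq (.fterm (.fx f)) (.fterm t₁) →
      L.key < (Literal.eq (.fterm (.fx f)) (.fterm t₁)).key ∧ ¬ (interpOf val).holds L)
    (hlt : (Literal.eq (.fterm (.fx f)) (.fterm t₁)).key < Literal.key ⟨pos, s(s, t)⟩)
    (hr : Term.Replace (.fterm (.fx f)) (.fterm t₁) s w) (hws : w < s) (hwv : w.Visible p)
    (hw : (interpOf val).eval w = (interpOf val).eval s) :
    ∃ C', D.Active v p Γ C' ∧ (∀ L ∈ C'.head, ¬ (interpOf val).holds L) ∧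
      toColex (C'.head.map keyEmb) < toColex (C.head.map keyEmb) := by
  classical
  have hhas := hD.eq (maximalIn_erase h.adm hC₁ (h.lower_lt ht₁) hL₁ fun L h h' => (hmax₁ L h h').1)
    (.inl (h.gt_lower ht₁)) (maximalIn_erase h.adm hC hts hL hmax) hst hr
  have hmem (L : Literal F P₁ P₂) (hL' : L ∈ C₁.head.erase (.eq (.fterm (.fx f)) (.fterm t₁)) ∪
      C.head.erase ⟨pos, s(s, t)⟩ ∪ {⟨pos, s(w, t)⟩}) :
      L.Visible p ∧ ¬ (interpOf val).holds L ∧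
        (L ∈ C.head ∧ L ≠ ⟨pos, s(s, t)⟩ ∨ L.key < Literal.key ⟨pos, s(s, t)⟩) := by
    simp only [Finset.mem_union, Finset.mem_erase, Finset.mem_singleton] at hL'
    rcases hL' with (⟨hne, hL'⟩ | ⟨hne, hL'⟩) | rfl
    · exact ⟨hC₁.1.2.2 L hL', (hmax₁ L hL' hne).2, .inr ((hmax₁ L hL' hne).1.trans hlt)⟩
    · exact ⟨hC.1.2.2 L hL', hfalse L hL', .inl ⟨hL', hne⟩⟩
    · refine ⟨Literal.visible_mk.2 ⟨hwv, (Literal.visible_mk.1 (hC.1.2.2 _ hL)).2⟩, ?_, .inr ?_⟩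
      · rw [LocalInterp.holds_mk, hw, ← LocalInterp.holds_mk]
        exact hfalse _ hL
      · rw [Literal.key_lt_iff]
        left
        simp [hws, hts]
  obtain ⟨C', hC', hsub⟩ := hD.exists_active (interpOf val) hhas
    (by
      simp only [Finset.coe_union, Set.union_subset_iff]
      exact ⟨hC₁.1.2.1, hC.1.2.1⟩)
    (fun L hL => (hmem L hL).1) (fun L hL => (hmem L hL).2.1)
  exact ⟨C', hC', fun L hL => (hmem L (hsub hL)).2.1,
    colex_lt_of_pivot hL fun L hL => (hmem L (hsub hL)).2.2⟩

end Construction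

end ContextStructure

/-! ### Reduction of minimal false clauses -/

namespace ContextStructure

variable {F P₁ P₂ : Type u} [LinearOrder F] [WellFoundedLT F] {O : Ontology F P₁ P₂} {V : Type*}
  {D : ContextStructure O V} {v : V} {p : Prop} {Γ Λ : Set (Atom F P₁ P₂)}

section Construction

variable [LinearOrder (Term F P₁ P₂)] {val : Term F P₁ P₂ → FTerm F ⊕ Prop}

/-- A false clause with the maximal literal `f(x) ≈ t` produces the rule `f(x) ⇒ t`, unless it can
be factored. -/
theorem produces_or_exists_smaller (hD : D.Saturated)
    (h : IsConstruction O (D.gt v) p Λ (D.Active v p Γ) val) {C : Clause F P₁ P₂}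
    (hC : D.Active v p Γ C) (hfalse : ∀ L ∈ C.head, ¬ (interpOf val).holds L) {f : F} {t : FTerm F}
    (ht : IsLower p f t) (hL : Literal.eq (.fterm (.fx f)) (.fterm t) ∈ C.head)
    (hmax : ∀ L ∈ C.head, L ≠ .eq (.fterm (.fx f)) (.fterm t) →
      L.key < (Literal.eq (.fterm (.fx f)) (.fterm t)).key) :
    Produces (D.Active v p Γ) (below val (.fterm (.fx f))) (.fterm (.fx f)) (.fterm t) ∨
    ∃ C', D.Active v p Γ C' ∧ (∀ L ∈ C'.head, ¬ (interpOf val).holds L) ∧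
      toColex (C'.head.map keyEmb) < toColex (C.head.map keyEmb) := by
  classical
  have htf := h.lower_lt ht
  -- Adding `f(x) ⇒ t` must not make another literal of the clause true. The only danger is a second
  -- equation `f(x) ≈ t₀` where `t₀` and `t` have the same normal form; Factor then replaces it by
  -- the smaller false literal `t₀ ≉ t`.
  by_cases hfac : ∃ t₀, Literal.eq (.fterm (.fx f)) (.fterm t₀) ∈ C.head ∧ t₀ ≠ t ∧
      IsLower p f t₀ ∧ (interpOf val).nf t₀ = (interpOf val).nf t
  · right
    obtain ⟨t₀, hL₀, hne, ht₀, hnf⟩ := hfac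
    have ht₀f := h.lower_lt ht₀
    have hne' : Literal.eq (.fterm (.fx f)) (.fterm t₀) ≠
        (Literal.eq (.fterm (.fx f)) (.fterm t) : Literal F P₁ P₂) := by
      simp only [Literal.eq, ne_eq, Literal.mk.injEq, true_and, Sym2.congr_right,
        Term.fterm.injEq]
      exact hne
    have hmaxi := maximalIn_erase h.adm hC htf hL hmax
    have herase : C.head.erase (.eq (.fterm (.fx f)) (.fterm t)) =
        insert (.eq (.fterm (.fx f)) (.fterm t₀))
          ((C.head.erase (.eq (.fterm (.fx f)) (.fterm t))).erase
            (.eq (.fterm (.fx f)) (.fterm t₀))) :=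
      (Finset.insert_erase (Finset.mem_erase.2 ⟨hne', hL₀⟩)).symm
    change D.MaximalIn v C.body (C.head.erase (.eq (.fterm (.fx f)) (.fterm t)))
      (.eq (.fterm (.fx f)) (.fterm t)) at hmaxi
    rw [herase] at hmaxi
    have hhas := hD.factor hmaxi (.inl (h.gt_lower ht))
    have hmem (L : Literal F P₁ P₂)
        (hL' : L ∈ (C.head.erase (.eq (.fterm (.fx f)) (.fterm t))).erase
            (.eq (.fterm (.fx f)) (.fterm t₀)) ∪
          {.ne (.fterm t₀) (.fterm t), .eq (.fterm (.fx f)) (.fterm t)}) :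
        L.Visible p ∧ ¬ (interpOf val).holds L ∧
          (L ∈ C.head ∧ L ≠ .eq (.fterm (.fx f)) (.fterm t₀) ∨
            L.key < (Literal.eq (.fterm (.fx f)) (.fterm t₀)).key) := by
      simp only [Finset.mem_union, Finset.mem_erase, Finset.mem_insert,
        Finset.mem_singleton] at hL'
      rcases hL' with ⟨hne₀, -, hL'⟩ | rfl | rfl
      · exact ⟨hC.1.2.2 L hL', hfalse L hL', .inl ⟨hL', hne₀⟩⟩
      · refine ⟨Literal.visible_mk.2 ⟨visible_lower ht₀, visible_lower ht⟩, ?_, .inr ?_⟩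
        · simp [LocalInterp.holds_ne, LocalInterp.eval, hnf]
        · rw [Literal.key_lt_iff]
          left
          simp only [Literal.ne, Literal.eq, Sym2.sup_mk]
          exact (max_lt ht₀f htf).trans_le le_sup_left
      · exact ⟨hC.1.2.2 _ hL, hfalse _ hL, .inl ⟨hL, hne'.symm⟩⟩
    obtain ⟨C', hC', hsub⟩ := hD.exists_active (interpOf val) hhas hC.1.2.1
      (fun L hL => (hmem L hL).1) (fun L hL => (hmem L hL).2.1)
    exact ⟨C', hC', fun L hL => (hmem L (hsub hL)).2.1,
      colex_lt_of_pivot hL₀ fun L hL => (hmem L (hsub hL)).2.2⟩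
  · left
    refine ⟨htf, by simp, C, hC, hL, fun L hLC hne => ⟨hmax L hLC hne, fun hL' => ?_⟩⟩
    have hlt := hmax L hLC hne
    obtain ⟨hctx, hvis, hy⟩ := h.ctx C hC L hLC
    have hw : (interpOf (below val (.fterm (.fx f)))).eval (.fterm t) =
        .inl ((interpOf val).nf t) := by
      rw [LocalInterp.eval, interpOf_nf_congr (below_of_lt htf)]
    rw [hw] at hL'
    rw [Literal.key_lt_iff] at hlt
    simp only [Literal.eq, Sym2.sup_mk, Sym2.inf_mk, sup_eq_left.2 htf.le,
      inf_eq_right.2 htf.le] at hlt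
    have hle : L.sides.sup ≤ .fterm (.fx f) := by
      rcases hlt with h' | h'
      exacts [h'.le, h'.1.le]
    have hvar (v : Var) : (Term.fterm (.fx f) : Term F P₁ P₂) ≠ .fterm (.var v) := by
      simp [FTerm.fx]
    by_cases hmem : .fterm (.fx f) ∈ L.sides
    · rcases hctx.cases_max with ⟨A, -, rfl⟩ | ⟨pos, t', -, rfl⟩ | ⟨pos, f', t', ht', rfl⟩
      · simp [Atom.lit, Literal.eq] at hmem
      · obtain rfl : FTerm.fx f = t' := by simpa using hmem
        simp [htf.not_gt] at hlt
      · have ht' := isLower_of_visible ht' (Literal.visible_mk.1 hvis).2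
        have ht'f := h.lower_lt ht'
        simp only [Sym2.sup_mk, Sym2.inf_mk, sup_eq_left.2 ht'f.le, inf_eq_right.2 ht'f.le]
          at hlt hle
        rcases Sym2.mem_iff.1 hmem with e | e
        · obtain rfl : f = f' := by simpa [FTerm.fx] using e
          -- With equal maximal sides an inequality would have the larger key, so the literal is an
          -- equation.
          simp only [lt_self_iff_false, false_or, true_and, Bool.true_eq_false, and_false] at hlt
          obtain ⟨rfl, hlt⟩ := hlt
          refine hfac ⟨t', hLC, ?_, ht', ?_⟩
          · rintro rfl
            exact lt_irrefl _ hlt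
          · rw [LocalInterp.holds_mk] at hL'
            have := hL'.2 rfl
            simp only [LocalInterp.eval, Sum.inl.injEq] at this
            rw [interpOf_nf_congr (ρ := Function.update _ _ _) (val := val) (t := t')
              (by rw [Function.update_of_ne ht'f.ne, below_of_lt ht'f])] at this
            rw [← this]
            simp [interpOf]
        · rw [e] at hle
          exact absurd ht'f hle.not_gt
    · refine hfalse L hLC ((LocalInterp.holds_congr fun s hs => ?_).1 hL')
      refine h.eval_update_below (hctx.isSide hy s hs) (hvis s hs) hvar
        ((Literal.le_sup hs).trans hle) ?_
      rintro rfl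
      exact absurd hs hmem

/-- The maximal literal decides. A reducible left-hand side is rewritten with its rule by Eq, and
`f(x) ≉ f(x)` is deleted by Ineq. An irreducible left-hand side of an equation or an atom
contradicts the construction, since the clause itself would have produced a rule unless Factor
applies. -/
theorem exists_smaller (hD : D.Saturated)
    (h : IsConstruction O (D.gt v) p Λ (D.Active v p Γ) val) {C : Clause F P₁ P₂}
    (hC : D.Active v p Γ C) (hne : C.head.Nonempty)
    (hfalse : ∀ L ∈ C.head, ¬ (interpOf val).holds L) :
    ∃ C', D.Active v p Γ C' ∧ (∀ L ∈ C'.head, ¬ (interpOf val).holds L) ∧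
      toColex (C'.head.map keyEmb) < toColex (C.head.map keyEmb) := by
  classical
  obtain ⟨L, hL, hmax⟩ := Finset.exists_max_image C.head Literal.key hne
  replace hmax : ∀ L' ∈ C.head, L' ≠ L → L'.key < L.key := fun L' hL' hne =>
    (hmax L' hL').lt_of_ne fun e => hne (Literal.key_injective e)
  obtain ⟨hctx, hvis, hy⟩ := h.ctx C hC L hL
  rcases hctx.cases_max with ⟨A, hA, rfl⟩ | ⟨pos, t, ht, rfl⟩ | ⟨pos, f, t, ht, rfl⟩
  · have hAv := Literal.visible_lit.1 hvis
    have htop := h.adm.top_lt (.atom A) hA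
    rcases h.replace_cases hA hAv with e | ⟨f, hf, hfA, hrep⟩
    · exfalso
      have hAJ : val (.atom A) ≠ .inr True := fun hv =>
        hfalse _ hL (by rw [LocalInterp.holds_lit, e]; exact hv)
      -- Either no rule rewrites `A`, although `C` is entitled to produce `A ⇒ TOP`, or such a rule
      -- exists and `A` is true.
      rcases h.cases (.atom A) with ⟨-, hn⟩ | ⟨t, hv, hp, -⟩
      · refine hn .top ⟨htop, ?_, C, hC, hL, fun L' hL' hne => ⟨hmax L' hL' hne, fun hh => ?_⟩⟩
        · rintro A' e'
          obtain rfl : A = A' := by simpa using e'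
          rw [h.mapF_congr hA hAv (fun s => below_of_lt) (h.below_var _), e]
        · obtain ⟨hctx', hvis', hy'⟩ := h.ctx C hC L' hL'
          refine hfalse L' hL' ((LocalInterp.holds_congr fun s hs => ?_).1 hh)
          refine h.eval_update_below (hctx'.isSide hy' s hs) (hvis' s hs) (by simp)
            ((Literal.le_sup hs).trans ?_) ?_
          · have := hmax L' hL' hne
            rw [Literal.key_lt_iff] at this
            simp only [Atom.lit, Literal.eq, Sym2.sup_mk, sup_eq_left.2 htop.le] at this
            rcases this with h' | h'
            exacts [h'.le, h'.1.le]
          · rintro rfl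
            exact absurd (hctx'.eq_lit hs) hne
      · rcases h.rule_cases hp with ⟨A', -, -, -, rfl⟩ | ⟨f, t', -, e', -⟩
        · exact hAJ hv
        · simp at e'
    · obtain ⟨t₁, ht₁, hnf, -, C₁, hC₁, hL₁, hmax₁⟩ := h.exists_producer_fx hf
      obtain ⟨A', hr, hA'v, hlt, hmap, -⟩ := hrep t₁ ht₁
      refine exists_smaller_of_rewrite hD h hC hfalse htop (.inr ⟨hA, rfl⟩) hL hmax ht₁ hC₁ hL₁
        hmax₁ ?_ hr hlt hA'v ?_
      · rw [Literal.key_lt_iff]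
        left
        simp only [Literal.eq, Sym2.sup_mk, sup_eq_left.2 htop.le, sup_eq_left.2 (h.lower_lt ht₁).le]
        exact hfA
      · simp [LocalInterp.eval, hmap hnf]
  · rcases ht with rfl | ⟨f, rfl⟩
    · exact absurd hL (hC.2 pos)
    · cases pos with
      | true => exact absurd ((LocalInterp.holds_eq _ _ _).2 rfl) (hfalse _ hL)
      | false =>
        have hins : (⟨C.body, insert (.ne (.fterm (.fx f)) (.fterm (.fx f))) (C.head.erase
            (.ne (.fterm (.fx f)) (.fterm (.fx f))))⟩ : Clause F P₁ P₂) ∈ D.S v := by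
          rw [Finset.insert_erase (show Literal.ne _ _ ∈ C.head from hL)]
          exact hC.1.1
        obtain ⟨C', hC', hsub⟩ := hD.exists_active (interpOf val) (hD.ineq hins) hC.1.2.1
          (fun L hL => hC.1.2.2 L (Finset.mem_of_mem_erase hL))
          (fun L hL => hfalse L (Finset.mem_of_mem_erase hL))
        refine ⟨C', hC', fun L hL => hfalse L (Finset.mem_of_mem_erase (hsub hL)),
          colex_lt_of_pivot hL fun L hL => .inl ?_⟩
        exact (Finset.mem_erase.1 (hsub hL)).symm
  · have ht := isLower_of_visible ht (Literal.visible_mk.1 hvis).2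
    have htf := h.lower_lt ht
    have rewriteStep {t₁ : FTerm F} (ht₁ : IsLower p f t₁)
        (hnf : (interpOf val).nf (.fx f) = (interpOf val).nf t₁) {C₁ : Clause F P₁ P₂}
        (hC₁ : D.Active v p Γ C₁) (hL₁ : Literal.eq (.fterm (.fx f)) (.fterm t₁) ∈ C₁.head)
        (hmax₁ : ∀ L ∈ C₁.head, L ≠ .eq (.fterm (.fx f)) (.fterm t₁) →
          L.key < (Literal.eq (.fterm (.fx f)) (.fterm t₁)).key ∧ ¬ (interpOf val).holds L)
        (hlt : pos = false ∨ pos = true ∧ (Term.fterm t₁ : Term F P₁ P₂) < .fterm t) :=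
      exists_smaller_of_rewrite hD h hC hfalse htf (.inl (h.gt_lower ht)) hL hmax ht₁ hC₁ hL₁
        hmax₁ (by
          rw [Literal.key_lt_iff]
          right
          simp only [Literal.eq, Sym2.sup_mk, sup_eq_left.2 htf.le, Sym2.inf_mk,
            sup_eq_left.2 (h.lower_lt ht₁).le, inf_eq_right.2 htf.le,
            inf_eq_right.2 (h.lower_lt ht₁).le]
          rcases hlt with rfl | ⟨rfl, hlt⟩ <;> simp [*])
        (.root _ _) (h.lower_lt ht₁) (visible_lower ht₁) (by simp [LocalInterp.eval, hnf])
    have hfL := hfalse _ hL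
    rw [LocalInterp.holds_mk] at hfL
    simp only [LocalInterp.eval, Sum.inl.injEq] at hfL
    cases pos with
    | false =>
      -- Falsity of `f(x) ≉ t` means equal normal forms. That of `t` is `y` or some `g(x)` with `g`
      -- smaller than `f`, so `f(x)` is reducible.
      have hf : (interpOf val).nf (.fx f) ≠ .fx f := by
        have hfL : (interpOf val).nf (.fx f) = (interpOf val).nf t := by simpa using hfL
        rw [hfL]
        rcases ht with ⟨rfl, -⟩ | ⟨g, hg, rfl⟩
        · simp [h.nf_var, FTerm.fx]
        · rcases h.nf_app g with ⟨e, -⟩ | ⟨g', hg', e, -⟩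
          · simp [e, FTerm.fx]
          · simp [e, FTerm.fx, (hg'.trans_lt hg).ne]
      obtain ⟨t₁, ht₁, hnf, -, C₁, hC₁, hL₁, hmax₁⟩ := h.exists_producer_fx hf
      exact rewriteStep ht₁ hnf hC₁ hL₁ hmax₁ (.inl rfl)
    | true =>
      have hfL : (interpOf val).nf (.fx f) ≠ (interpOf val).nf t := by simpa using hfL
      rcases produces_or_exists_smaller hD h hC hfalse ht hL hmax with hp | hs
      · by_cases hf : (interpOf val).nf (.fx f) = .fx f
        · rcases h.nf_fx f with ⟨-, hn⟩ | ⟨t', hl, e, -⟩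
          · exact absurd hp (hn _)
          · rw [hf] at e
            exfalso
            rcases hl with ⟨rfl, -⟩ | ⟨g, hg, rfl⟩
            · simp [h.nf_var, FTerm.fx] at e
            · rcases h.nf_app g with ⟨e', -⟩ | ⟨g', hg', e', -⟩
              · simp [e', FTerm.fx] at e
              · simp [e', FTerm.fx, (hg'.trans_lt hg).ne'] at e
        · obtain ⟨t₁, ht₁, hnf, hmin, C₁, hC₁, hL₁, hmax₁⟩ := h.exists_producer_fx hf
          -- The clause could produce `f(x) ⇒ t`, so the chosen right-hand side `t₁` is at most `t`;
          -- equality would make the literal true.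
          refine rewriteStep ht₁ hnf hC₁ hL₁ hmax₁ (.inr ⟨rfl, (hmin _ hp).lt_of_ne ?_⟩)
          rintro e
          obtain rfl : t₁ = t := by simpa using e
          exact hfL hnf
      · exact hs

/-- The interpretation constructed from a saturated set satisfies all active clauses. -/
theorem models_active (hD : D.Saturated)
    (h : IsConstruction O (D.gt v) p Λ (D.Active v p Γ) val)
    (hne : ∀ C, D.Active v p Γ C → C.head.Nonempty) (C : Clause F P₁ P₂)
    (hC : D.Active v p Γ C) : ∃ L ∈ C.head, (interpOf val).holds L := by
  by_contra! hfalse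
  obtain ⟨C₀, ⟨hC₀, hfalse₀⟩, hmin⟩ := Set.exists_min_image
    {C | D.Active v p Γ C ∧ ∀ L ∈ C.head, ¬ (interpOf val).holds L}
    (fun C => toColex (C.head.map keyEmb))
    ((D.S v).finite_toSet.subset fun C hC => hC.1.1.1) ⟨C, hC, hfalse⟩
  obtain ⟨C', hC', hfalse', hlt⟩ := exists_smaller hD h hC₀ (hne C₀ hC₀) hfalse₀
  exact absurd hlt (hmin C' ⟨hC', hfalse'⟩).not_gt

end Construction

/-- A refutable clause has a local countermodel. -/
theorem Refutable.exists_isLocalModel (hR : D.Refutable v p Γ Λ) (hD : D.Saturated) :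
    ∃ J, D.IsLocalModel v p Γ Λ J := by
  classical
  obtain ⟨lo, adm⟩ := (D.order v).exists_isAdmissible hR.low
  obtain ⟨val, hval⟩ := exists_values (D.Active v p Γ)
    ((D.S v).finite_toSet.subset fun C hC => hC.1.1)
  have h : IsConstruction O (D.gt v) p Λ (D.Active v p Γ) val :=
    ⟨adm, D.order v, fun C hC L hL => ⟨(D.clauses_context v C hC.1.1).head L hL, hC.1.2.2 L hL,
      fun pos e => hC.2 pos (e ▸ hL)⟩, hval⟩
  have hactive := models_active hD h fun C hC => by
    rw [Finset.nonempty_iff_ne_empty]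
    intro e
    exact hR.not_derived C hC.1.1 hC.1.2.1 (by simp [e])
  have hmodels : ∀ C, D.Relevant v p Γ C → ∃ L ∈ C.head, (interpOf val).holds L := by
    intro C hC
    by_contra! hfalse
    obtain ⟨C', hC', hsub⟩ := hD.exists_active (interpOf val)
      (.inr (.inr ⟨C, hC.1, subset_rfl, subset_rfl⟩)) hC.2.1 hC.2.2 hfalse
    obtain ⟨L, hL, hL'⟩ := hactive C' hC'
    exact hfalse L (hsub hL) hL'
  refine ⟨interpOf val, h.nf_var, fun f => ?_, fun A hA => (h.exists_producer_atom hA).1,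
    fun A hA => (h.exists_producer_atom hA).2.1, fun A hA => (h.exists_producer_atom hA).2.2.1,
    fun A hA => ?_, hmodels, fun A hA => ?_, fun A hA hA' => ?_⟩
  · rcases h.nf_app f with h' | ⟨g, -, h'⟩
    exacts [.inl h', .inr ⟨g, h'⟩]
  · obtain ⟨hctx, -, -, C, hC, hL, hmax⟩ := h.exists_producer_atom hA
    refine ⟨C.body, C.head.erase A.lit, maximalIn_erase adm hC (adm.top_lt (.atom A) hctx) hL
      fun L hL hne => (hmax L hL hne).1, hC.1.2.1, fun L hL => ?_⟩
    obtain ⟨hne, hL⟩ := Finset.mem_erase.1 hL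
    exact ⟨hC.1.2.2 L hL, (hmax L hL hne).2⟩
  · obtain ⟨C, hC, hbody, hhead⟩ := hR.derives A hA
    obtain ⟨L, hL, hL'⟩ := hmodels C ⟨hC, hbody, fun L hL => by
      rw [Finset.mem_singleton.1 (hhead hL)]
      exact Literal.visible_lit.2 (hR.visible A hA)⟩
    rw [Finset.mem_singleton.1 (hhead hL)] at hL'
    exact (LocalInterp.holds_lit _ _).1 hL'
  · obtain ⟨hctx, -, -, C, hC, hL, hmax⟩ := h.exists_producer_atom hA'
    -- The producer of an atom of `Λ` has no literal with a side above that atom. Terms `f(x)` and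
    -- atoms outside `Λ` are above it, so the head lies in `Λ`.
    refine hR.not_derived C hC.1.1 hC.1.2.1 fun L hLC => ?_
    by_cases hne : L = A.lit
    · exact ⟨A, hA, hne⟩
    have hlt := (hmax L hLC hne).1
    have hle {t : Term F P₁ P₂} (ht : t ∈ L.sides) : t ≤ .atom A := by
      refine (Literal.le_sup ht).trans ?_
      rw [Literal.key_lt_iff] at hlt
      simp only [Atom.lit, Literal.eq, Sym2.sup_mk,
        sup_eq_left.2 (adm.top_lt (.atom A) hctx).le] at hlt
      rcases hlt with h' | h'
      exacts [h'.le, h'.1.le]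
    have hfx (f : F) (hf : .fterm (.fx f) ∈ L.sides) : False :=
      (hle hf).not_gt (adm.low_lt A hA (.fterm (.fx f)) (IsContextFTerm.fx f) (by simp [FTerm.fx])
        (by simp [FTerm.fx]) (by simp))
    rcases ((D.clauses_context v C hC.1.1).head L hLC).cases_max with
      ⟨A', hA', rfl⟩ | ⟨pos, t, rfl | ⟨f, rfl⟩, rfl⟩ | ⟨pos, f, t, -, rfl⟩
    · by_contra hn
      refine (hle (t := .atom A') (by simp [Atom.lit, Literal.eq])).not_gt
        (adm.low_lt A hA (.atom A') hA' (by simp) (by simp) ?_)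
      rintro A'' hA'' e
      obtain rfl : A' = A'' := by simpa using e
      exact hn ⟨A', hA'', rfl⟩
    · exact absurd hLC (hC.2 pos)
    · exact (hfx f (by simp)).elim
    · exact (hfx f (by simp)).elim

end ContextStructure

/-! ### Triggers and global satisfaction -/

section Triggers

variable {F P₁ P₂ : Type u} {O : Ontology F P₁ P₂}

theorem Interp.holdsL_mk {U : Type u} (I : Interp F P₁ P₂ U) (ν : Var → U) (pos : Bool)
    (s t : Term F P₁ P₂) :
    I.holdsL ν ⟨pos, s(s, t)⟩ ↔ (I.eval ν s = I.eval ν t ↔ pos = true) := by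
  simp [Interp.holdsL]

theorem Interp.holdsL_lit {U : Type u} (I : Interp F P₁ P₂ U) (ν : Var → U) (A : Atom F P₁ P₂) :
    I.holdsL ν A.lit ↔ I.evalA ν A := by
  simp [Atom.lit, Literal.eq, Interp.holdsL_mk, Interp.eval]

theorem Atom.lit_subst (A : Atom F P₁ P₂) (σ : Var → FTerm F) :
    A.lit.subst σ = (A.subst σ).lit := by
  simp [Atom.lit, Literal.eq, Literal.subst, Term.subst]

theorem cases_of_mem_Su {A : Atom F P₁ P₂} (h : A ∈ Su O) :
    (∃ B, A = .un B .x) ∨ (∃ S, A = .bin S .x .y) ∨ ∃ S, A = .bin S .y .x := by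
  rcases h with ⟨_, _⟩ | ⟨_, _⟩ | ⟨_, _⟩
  exacts [.inl ⟨_, rfl⟩, .inr (.inl ⟨_, rfl⟩), .inr (.inr ⟨_, rfl⟩)]

theorem cases_of_mem_Pr {A : Atom F P₁ P₂} (h : A ∈ Pr O) :
    (∃ B, A = .un B .y) ∨ (∃ S, A = .bin S .x .y) ∨ ∃ S, A = .bin S .y .x := by
  rcases h with ⟨A, hA, rfl⟩ | ⟨B, -, rfl⟩
  · rcases cases_of_mem_Su hA with ⟨B, rfl⟩ | ⟨S, rfl⟩ | ⟨S, rfl⟩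
    exacts [.inl ⟨B, rfl⟩, .inr (.inr ⟨S, rfl⟩), .inr (.inl ⟨S, rfl⟩)]
  · exact .inl ⟨B, rfl⟩

end Triggers

/-! ### Elements of the tree and successor states -/

namespace ContextStructure

section Elements

variable {F : Type u}

/-- The element of the model denoted by a context term at the element `l`. -/
def elementAt (l : List F) : FTerm F → List F
  | .var .x => l
  | .var _ => l.tail
  | .app f _ => f :: l

open Classical in
/-- The context term denoting the value of a variable at the element `ν x`. -/
noncomputable def contextSubst (ν : Var → List F) : Var → FTerm F
  -- The default `y` is meant for the parent. Variables denoting neither a child nor the parent do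
  -- not occur in a satisfied body, hence by safety not in its head.
  | .z i => if h : ∃ f, ν (.z i) = f :: ν .x then .fx h.choose else .y
  | w => .var w

theorem contextSubst_of_succ {ν : Var → List F} {i : ℕ} {f : F} (h : ν (.z i) = f :: ν .x) :
    contextSubst ν (.z i) = .fx f := by
  have hex : ∃ f, ν (.z i) = f :: ν .x := ⟨f, h⟩
  have := h.symm.trans hex.choose_spec
  rw [contextSubst, dif_pos hex, ← (List.cons.inj this).1]

theorem contextSubst_of_pred {ν : Var → List F} {i : ℕ} {f : F} (h : ν .x = f :: ν (.z i)) :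
    contextSubst ν (.z i) = .y := by
  rw [contextSubst, dif_neg]
  rintro ⟨g, hg⟩
  rw [h] at hg
  have := congrArg List.length hg
  simp only [List.length_cons] at this
  omega

/-- The model value of a function term matches its normal form in the local model. -/
def Denotes (l : List F) (t : FTerm F) (m : List F) : Prop :=
  (t = .y ∧ ∃ f, l = f :: m) ∨ ∃ g, t = .fx g ∧ m = g :: l

/-- The parent is a shorter list and the children are distinct longer ones, so distinct normal forms
denote distinct elements. This transfers equations and inequalities alike. -/
theorem Denotes.eq_iff {l m m' : List F} {t t' : FTerm F} (h : Denotes l t m)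
    (h' : Denotes l t' m') : t = t' ↔ m = m' := by
  rcases h with ⟨rfl, f, hf⟩ | ⟨g, rfl, rfl⟩ <;> rcases h' with ⟨rfl, f', hf'⟩ | ⟨g', rfl, rfl⟩
  · simpa using (List.cons.inj (hf.symm.trans hf')).2
  · simp only [FTerm.fx, reduceCtorEq, false_iff]
    rintro rfl
    have := congrArg List.length hf
    simp only [List.length_cons] at this
    omega
  · simp only [FTerm.fx, reduceCtorEq, false_iff]
    rintro rfl
    have := congrArg List.length hf'
    simp only [List.length_cons] at this
    omega
  · simp [FTerm.fx]

end Elements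

variable {F P₁ P₂ : Type u} [LinearOrder F] {O : Ontology F P₁ P₂} {V : Type*}
  {D : ContextStructure O V}

theorem IsLocalModel.exists_holds {v : V} {p : Prop} {Γ Λ : Set (Atom F P₁ P₂)}
    {J : LocalInterp F P₁ P₂} (hJ : D.IsLocalModel v p Γ Λ J) {E : Clause F P₁ P₂}
    (hE : D.Has v E) (hbody : (E.body : Set (Atom F P₁ P₂)) ⊆ Γ)
    (hvis : ∀ L ∈ E.head, L.Visible p) : ∃ L ∈ E.head, J.holds L := by
  by_contra! hfalse
  obtain ⟨C, hC, hCb, hCh⟩ := hE.exists_subset J hfalse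
  obtain ⟨L, hL, hL'⟩ := hJ.models C
    ⟨hC, (Finset.coe_subset.2 hCb).trans hbody, fun L hL => hvis L (hCh hL)⟩
  exact hfalse L (hCh hL) hL'

theorem IsLocalModel.nf_fx_of_fact {v : V} {p : Prop} {Γ Λ : Set (Atom F P₁ P₂)}
    {J : LocalInterp F P₁ P₂} (hJ : D.IsLocalModel v p Γ Λ J) {A : Atom F P₁ P₂}
    (hA : A ∈ J.facts) {f : F} (hf : (Term.fterm (.fx f)).IsSubterm (.atom A : Term F P₁ P₂)) :
    J.nf (.fx f) = .fx f := by
  have hctx := hJ.fact_context A hA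
  have hnorm := hJ.fact_normal A hA
  rcases hctx with ⟨⟨⟩⟩ | _ | _ | _ <;>
    simp [Term.IsSubterm, FTerm.IsSubterm, FTerm.fx, Atom.mapF] at hf hnorm
  · subst hf; exact hnorm
  · subst hf; exact hnorm.2
  · subst hf; exact hnorm.1

/-- A local model of some context. -/
structure LocalState (D : ContextStructure O V) where
  v : V
  p : Prop
  Γ : Set (Atom F P₁ P₂)
  Λ : Set (Atom F P₁ P₂)
  J : LocalInterp F P₁ P₂
  isModel : D.IsLocalModel v p Γ Λ J

/-- `st'` describes the element `f(x)` of `st`. -/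
def IsSuccessor (st : LocalState D) (f : F) (st' : LocalState D) : Prop :=
  st'.Γ = {A | A ∈ Su O ∧ A.subst (succSubst f) ∈ st.J.facts} ∧
  st'.Λ = {A | A ∈ Pr O ∧ A.subst (succSubst f) ∉ st.J.facts}

/-- Succ supplies the context and the derivations of `Γ`, and Pred excludes a clause that refutes
the required trigger values. The fact that mentions `f(x)` also guarantees that `f(x)` is
irreducible. -/
theorem exists_isSuccessor [WellFoundedLT F] (hD : D.Saturated) (st : LocalState D) {f : F}
    {A : Atom F P₁ P₂} (hA : A ∈ st.J.facts)
    (hf : (Term.fterm (.fx f)).IsSubterm (.atom A : Term F P₁ P₂)) :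
    ∃ st', IsSuccessor st f st' := by
  classical
  have hJ := st.isModel
  have hnf := hJ.nf_fx_of_fact hA hf
  obtain ⟨Γ₀, Δ₀, hmax, -⟩ := hJ.fact_maximal A hA
  obtain ⟨w, hE, hK⟩ := hD.succ hmax hf
  have hR : D.Refutable w True {A | A ∈ Su O ∧ A.subst (succSubst f) ∈ st.J.facts}
      {A | A ∈ Pr O ∧ A.subst (succSubst f) ∉ st.J.facts} := by
    refine ⟨fun C hC hbody hhead => ?_, fun A' hA' => ?_, fun _ _ => .inl trivial,
      fun A' hA' => ?_, fun A' hA' s hs hsx hsy _ hgt => ?_⟩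
    -- Each body atom of `C` is a fact of the parent and thus maximal in a clause with otherwise
    -- false literals. Pred would combine these into a relevant clause that is false at the parent.
    · have hex (A' : Atom F P₁ P₂) : ∃ Γ₁ Δ₁, A' ∈ C.body →
          D.MaximalIn st.v Γ₁ Δ₁ (A'.subst (succSubst f)).lit ∧
          (Γ₁ : Set (Atom F P₁ P₂)) ⊆ st.Γ ∧ ∀ L ∈ Δ₁, L.Visible st.p ∧ ¬ st.J.holds L := by
        by_cases hA' : A' ∈ C.body
        · obtain ⟨Γ₁, Δ₁, h⟩ := hJ.fact_maximal _ (hbody hA').2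
          exact ⟨Γ₁, Δ₁, fun _ => h⟩
        · exact ⟨∅, ∅, fun h => absurd h hA'⟩
      choose Γ₁ Δ₁ h₁ using hex
      have hhas := hD.pred hE hC (fun L hL => by
        obtain ⟨A', hA', e⟩ := hhead L hL
        exact ⟨A', hA'.1, e⟩) fun A' hA' => (h₁ A' hA').1
      have hmem (L : Literal F P₁ P₂) (hL : L ∈ C.body.biUnion Δ₁ ∪
          C.head.image (Literal.subst (succSubst f))) : L.Visible st.p ∧ ¬ st.J.holds L := by
        rcases Finset.mem_union.1 hL with hL | hL
        · obtain ⟨A', hA', hL⟩ := Finset.mem_biUnion.1 hL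
          exact (h₁ A' hA').2.2 L hL
        · obtain ⟨L', hL', rfl⟩ := Finset.mem_image.1 hL
          obtain ⟨A', ⟨hPr, hfalse⟩, rfl⟩ := hhead L' hL'
          rw [Atom.lit_subst, Literal.visible_lit, LocalInterp.holds_lit]
          have hx := hJ.nf_var .x
          rcases cases_of_mem_Pr hPr with ⟨B, rfl⟩ | ⟨S, rfl⟩ | ⟨S, rfl⟩ <;>
            refine ⟨.inr (by simp [Term.HasVar, Atom.HasVar, Atom.subst, FTerm.subst, succSubst,
              FTerm.HasVar]), fun h => hfalse ?_⟩ <;>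
            simpa [Atom.subst, FTerm.subst, succSubst, Atom.mapF, hx, hnf] using h
      obtain ⟨L, hL, hL'⟩ := hJ.exists_holds hhas (by
        simp only [Finset.coe_biUnion, Set.iUnion_subset_iff]
        exact fun A' hA' => (h₁ A' hA').2.1) fun L hL => (hmem L hL).1
      exact (hmem L hL).2 hL'
    -- Core derives the core atoms outright. For other triggers Succ gives `A' → A'`, whose body
    -- atom belongs to `Γ`.
    · by_cases hcore : A' ∈ D.core w
      · exact ⟨_, hD.core hcore, by simp, subset_rfl⟩
      · obtain ⟨Γ₁, Δ₁, h₁, -⟩ := hJ.fact_maximal _ hA'.2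
        obtain ⟨C, hC, hCb, hCh⟩ := (hK A' ⟨hA'.1, Γ₁, Δ₁, h₁⟩ hcore).exists_subset_of_atoms
          fun L hL => ⟨A', Finset.mem_singleton.1 hL⟩
        refine ⟨C, hC, fun A'' hA'' => ?_, hCh⟩
        rw [Finset.mem_singleton.1 (hCb hA'')]
        exact hA'
    · rcases cases_of_mem_Pr hA'.1 with ⟨B, rfl⟩ | ⟨S, rfl⟩ | ⟨S, rfl⟩
      exacts [.By B, .Sxy S, .Syx S]
    · exact absurd hgt ((D.order w).pr A' hA'.1 s hs hsx hsy)
  obtain ⟨J, hJ'⟩ := hR.exists_isLocalModel hD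
  exact ⟨⟨w, True, _, _, J, hJ'⟩, rfl, rfl⟩

/-! ### The tree model and its satisfaction of the ontology -/

section Model

open Classical in
/-- The state of the element `f(x)`: a fresh copy of the root if no fact mentions `f(x)`. -/
noncomputable def nextState (root st : LocalState D) (f : F) : LocalState D :=
  if h : ∃ st', IsSuccessor st f st' then h.choose else root

/-- The states of the elements of the model, which are the lists of function symbols. -/
noncomputable def state (root : LocalState D) : List F → LocalState D
  | [] => root
  | f :: l => nextState root (state root l) f

/-- The model obtained by joining the local models. -/
noncomputable def treeModel (root : LocalState D) : Interp F P₁ P₂ (List F) where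
  fn f l := elementAt l ((state root l).J.nf (.fx f))
  un B l := .un B .x ∈ (state root l).J.facts ∨
    ∃ f l', l = f :: l' ∧ .un B (.fx f) ∈ (state root l').J.facts
  -- Both endpoints are consulted, since a binary fact that is not a trigger need not be shared by
  -- neighbouring local models.
  bin S l m :=
    (∃ f, m = f :: l ∧ (.bin S .x (.fx f) ∈ (state root l).J.facts ∨
      .bin S .y .x ∈ (state root m).J.facts)) ∨
    ∃ f, l = f :: m ∧ (.bin S (.fx f) .x ∈ (state root m).J.facts ∨
      .bin S .x .y ∈ (state root l).J.facts)

variable {root : LocalState D}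

theorem isSuccessor_state [WellFoundedLT F] (hD : D.Saturated) {l : List F} {f : F}
    {A : Atom F P₁ P₂} (hA : A ∈ (state root l).J.facts)
    (hf : (Term.fterm (.fx f)).IsSubterm (.atom A : Term F P₁ P₂)) :
    IsSuccessor (state root l) f (state root (f :: l)) := by
  have h := exists_isSuccessor hD _ hA hf
  rw [state, nextState, dif_pos h]
  exact h.choose_spec

theorem facts_down [WellFoundedLT F] (hD : D.Saturated) {l : List F} {f : F} {A : Atom F P₁ P₂}
    (hA : A ∈ Su O) (h : A.subst (succSubst f) ∈ (state root l).J.facts) :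
    A ∈ (state root (f :: l)).J.facts := by
  have hs := isSuccessor_state hD h (f := f) (by
    rcases cases_of_mem_Su hA with ⟨B, rfl⟩ | ⟨S, rfl⟩ | ⟨S, rfl⟩ <;>
      simp [Term.IsSubterm, FTerm.IsSubterm, FTerm.fx, Atom.subst, FTerm.subst, succSubst])
  have hJ := (state root (f :: l)).isModel
  have := hJ.true_body A (by rw [hs.1]; exact ⟨hA, h⟩)
  have hx := hJ.nf_var .x
  have hy := hJ.nf_var .y
  rcases cases_of_mem_Su hA with ⟨B, rfl⟩ | ⟨S, rfl⟩ | ⟨S, rfl⟩ <;> simpa [Atom.mapF, hx, hy] using this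

/-- A successor state falsifies every predecessor trigger that is false at the parent. A copy of the
root satisfies none at all, because each contains `y`. -/
theorem facts_up (hroot : ¬ root.p) {l : List F} {f : F} {A : Atom F P₁ P₂}
    (hA : A ∈ Pr O) (h : A ∈ (state root (f :: l)).J.facts) :
    A.subst (succSubst f) ∈ (state root l).J.facts := by
  by_contra hn
  by_cases hex : ∃ st', IsSuccessor (state root l) f st'
  · have hs : IsSuccessor (state root l) f (state root (f :: l)) := by
      rw [state, nextState, dif_pos hex]
      exact hex.choose_spec
    exact (state root (f :: l)).isModel.false_head A (by rw [hs.2]; exact ⟨hA, hn⟩) h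
  · have he : state root (f :: l) = root := by rw [state, nextState, dif_neg hex]
    rw [he] at h
    rcases root.isModel.fact_visible A h with hp | hv
    · exact hroot hp
    · rcases cases_of_mem_Pr hA with ⟨B, rfl⟩ | ⟨S, rfl⟩ | ⟨S, rfl⟩ <;>
        simp [Term.HasVar, Atom.HasVar, FTerm.HasVar] at hv

theorem exists_eq_cons_of_p (hroot : ¬ root.p) {l : List F} (h : (state root l).p) :
    ∃ f m, l = f :: m := by
  cases l with
  | nil => exact absurd h hroot
  | cons f m => exact ⟨f, m, rfl⟩

/-- A body atom true in the model is a fact of the local model. -/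
theorem body_facts [WellFoundedLT F] (hD : D.Saturated) (hroot : ¬ root.p)
    {C : Clause F P₁ P₂} (hC : C ∈ O.clauses) {A : Atom F P₁ P₂} (hA : A ∈ C.body)
    {ν : Var → List F} (h : (treeModel root).evalA ν A) :
    A.subst (contextSubst ν) ∈ (state root (ν .x)).J.facts ∧
      ∀ i, A.HasVar (.z i) → (∃ f, ν (.z i) = f :: ν .x) ∨ ∃ f, ν .x = f :: ν (.z i) := by
  have hx : contextSubst ν .x = .x := rfl
  rcases (O.dl C hC).body A hA with B | ⟨S, i⟩ | ⟨S, i⟩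
  · refine ⟨?_, by simp [Atom.HasVar, FTerm.HasVar]⟩
    simp only [Atom.subst, FTerm.subst, hx]
    rcases h with h | ⟨f, l', e, h⟩
    · exact h
    · change ν .x = f :: l' at e
      rw [e]
      exact facts_down hD (.Bx hC hA) h
  · have hSu : .bin S .x .y ∈ Su O := .Sxy hC hA
    have hPr : (.bin S .y .x : Atom F P₁ P₂) ∈ Pr O := .inl ⟨_, hSu, rfl⟩
    simp only [Atom.subst, FTerm.subst, hx]
    rcases h with ⟨f, e, h⟩ | ⟨f, e, h⟩
    · change ν (.z i) = f :: ν .x at e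
      refine ⟨?_, fun j hj => ?_⟩
      · rw [contextSubst_of_succ e]
        rcases h with h | h
        · exact h
        · change _ ∈ (state root (ν (.z i))).J.facts at h
          rw [e] at h
          exact facts_up hroot hPr h
      · obtain rfl : j = i := by simpa [Atom.HasVar, FTerm.HasVar] using hj
        exact .inl ⟨f, e⟩
    · change ν .x = f :: ν (.z i) at e
      refine ⟨?_, fun j hj => ?_⟩
      · rw [contextSubst_of_pred e]
        rcases h with h | h
        · rw [e]
          exact facts_down hD hSu h
        · exact h
      · obtain rfl : j = i := by simpa [Atom.HasVar, FTerm.HasVar] using hj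
        exact .inr ⟨f, e⟩
  · have hSu : .bin S .y .x ∈ Su O := .Syx hC hA
    have hPr : (.bin S .x .y : Atom F P₁ P₂) ∈ Pr O := .inl ⟨_, hSu, rfl⟩
    simp only [Atom.subst, FTerm.subst, hx]
    rcases h with ⟨f, e, h⟩ | ⟨f, e, h⟩
    · change ν .x = f :: ν (.z i) at e
      refine ⟨?_, fun j hj => ?_⟩
      · rw [contextSubst_of_pred e]
        rcases h with h | h
        · rw [e]
          exact facts_down hD hSu h
        · exact h
      · obtain rfl : j = i := by simpa [Atom.HasVar, FTerm.HasVar] using hj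
        exact .inr ⟨f, e⟩
    · change ν (.z i) = f :: ν .x at e
      refine ⟨?_, fun j hj => ?_⟩
      · rw [contextSubst_of_succ e]
        rcases h with h | h
        · exact h
        · change _ ∈ (state root (ν (.z i))).J.facts at h
          rw [e] at h
          exact facts_up hroot hPr h
      · obtain rfl : j = i := by simpa [Atom.HasVar, FTerm.HasVar] using hj
        exact .inl ⟨f, e⟩

theorem denotes_fx (hroot : ¬ root.p) (ν : Var → List F) (f : F) :
    Denotes (ν .x) ((state root (ν .x)).J.nf ((FTerm.fx f).subst (contextSubst ν)))
      ((treeModel root).evalF ν (.fx f)) := by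
  change Denotes (ν .x) ((state root (ν .x)).J.nf (.fx f))
    (elementAt (ν .x) ((state root (ν .x)).J.nf (.fx f)))
  rcases (state root (ν .x)).isModel.nf_fx f with ⟨e, hp⟩ | ⟨g, e, -⟩ <;> rw [e]
  · obtain ⟨g, m, hm⟩ := exists_eq_cons_of_p hroot hp
    exact .inl ⟨rfl, g, by simp [elementAt, hm]⟩
  · exact .inr ⟨g, rfl, rfl⟩

/-- A neighbour variable occurs in a body atom, hence in a local fact. If it denotes a child, the
corresponding `f(x)` appears in that fact and is its own normal form. -/
theorem denotes_z [WellFoundedLT F] (hD : D.Saturated) (hroot : ¬ root.p) {C : Clause F P₁ P₂}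
    (hC : C ∈ O.clauses) {ν : Var → List F} (h : ∀ A ∈ C.body, (treeModel root).evalA ν A) {i : ℕ}
    (hi : ∃ A ∈ C.body, A.HasVar (.z i)) :
    Denotes (ν .x) ((state root (ν .x)).J.nf ((FTerm.z i).subst (contextSubst ν)))
      ((treeModel root).evalF ν (.z i)) := by
  obtain ⟨A, hA, hAi⟩ := hi
  obtain ⟨hfact, hcases⟩ := body_facts hD hroot hC hA (h A hA)
  have hJ := (state root (ν .x)).isModel
  change Denotes (ν .x) ((state root (ν .x)).J.nf (contextSubst ν (.z i))) (ν (.z i))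
  rcases hcases i hAi with ⟨f, e⟩ | ⟨f, e⟩
  · rw [contextSubst_of_succ e] at *
    rw [hJ.nf_fx_of_fact (f := f) hfact ?_]
    · exact .inr ⟨f, rfl, e⟩
    · have hσ := contextSubst_of_succ e
      rcases (O.dl C hC).body A hA with B | ⟨S, j⟩ | ⟨S, j⟩
      · simp [Atom.HasVar, FTerm.HasVar] at hAi
      · obtain rfl : i = j := by simpa [Atom.HasVar, FTerm.HasVar] using hAi
        simp [Term.IsSubterm, FTerm.IsSubterm, Atom.subst, FTerm.subst, hσ]
      · obtain rfl : i = j := by simpa [Atom.HasVar, FTerm.HasVar] using hAi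
        simp [Term.IsSubterm, FTerm.IsSubterm, Atom.subst, FTerm.subst, hσ]
  · rw [contextSubst_of_pred e]
    exact .inl ⟨hJ.nf_var .y, f, e⟩

/-- A unary fact about `y` must reach the parent, as the model does not look for unary facts at
children. For this purpose `Pr O` contains `B(y)` for every unary `B` of the ontology. -/
theorem holds_un (hroot : ¬ root.p) {l m : List F} {t : FTerm F} {B : P₁} (hB : O.HasUnary B)
    (ht : Denotes l t m) (h : .un B t ∈ (state root l).J.facts) :
    (treeModel root).un B m := by
  rcases ht with ⟨rfl, f, rfl⟩ | ⟨g, rfl, rfl⟩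
  · exact .inl (facts_up hroot (.inr ⟨B, hB, rfl⟩) h)
  · exact .inr ⟨g, l, rfl, h⟩

theorem holds_bin_left {l m : List F} {t : FTerm F} {S : P₂} (ht : Denotes l t m)
    (h : .bin S .x t ∈ (state root l).J.facts) : (treeModel root).bin S l m := by
  rcases ht with ⟨rfl, f, rfl⟩ | ⟨g, rfl, rfl⟩
  · exact .inr ⟨f, rfl, .inr h⟩
  · exact .inl ⟨g, rfl, .inl h⟩

theorem holds_bin_right {l m : List F} {t : FTerm F} {S : P₂} (ht : Denotes l t m)
    (h : .bin S t .x ∈ (state root l).J.facts) : (treeModel root).bin S m l := by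
  rcases ht with ⟨rfl, f, rfl⟩ | ⟨g, rfl, rfl⟩
  · exact .inl ⟨f, rfl, .inr h⟩
  · exact .inr ⟨g, rfl, .inl h⟩

theorem holdsL_of_holds {l : List F} {ν : Var → List F} {J : LocalInterp F P₁ P₂} {pos : Bool}
    {s t : FTerm F}
    (hs : Denotes l (J.nf (s.subst (contextSubst ν))) ((treeModel root).evalF ν s))
    (ht : Denotes l (J.nf (t.subst (contextSubst ν))) ((treeModel root).evalF ν t))
    (h : J.holds (Literal.subst (contextSubst ν) ⟨pos, s(.fterm s, .fterm t)⟩)) :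
    (treeModel root).holdsL ν ⟨pos, s(.fterm s, .fterm t)⟩ := by
  simp only [Literal.subst, Sym2.map_mk, Term.subst, LocalInterp.holds_mk,
    LocalInterp.eval, Sum.inl.injEq] at h
  rw [Interp.holdsL_mk]
  simpa only [Interp.eval, Sum.inl.injEq, ← hs.eq_iff ht] using h

/-- The true body consists of facts of the state at `ν x`, each maximal in a clause with otherwise
false literals. Hyper combines these clauses, and only an instance of the head of `C` can then be
true. -/
theorem treeModel_models [WellFoundedLT F] (hD : D.Saturated) (hroot : ¬ root.p)
    {C : Clause F P₁ P₂} (hC : C ∈ O.clauses) : (treeModel root).models C := by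
  classical
  intro ν hbody
  have hJ := (state root (ν .x)).isModel
  have hx := hJ.nf_var .x
  have hdl := O.dl C hC
  have hfacts (A : Atom F P₁ P₂) (hA : A ∈ C.body) := (body_facts hD hroot hC hA (hbody A hA)).1
  have hex (A : Atom F P₁ P₂) : ∃ Γ₁ Δ₁, A ∈ C.body →
      D.MaximalIn (state root (ν .x)).v Γ₁ Δ₁ (A.subst (contextSubst ν)).lit ∧
      (Γ₁ : Set (Atom F P₁ P₂)) ⊆ (state root (ν .x)).Γ ∧
      ∀ L ∈ Δ₁, L.Visible (state root (ν .x)).p ∧ ¬ (state root (ν .x)).J.holds L := by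
    by_cases hA : A ∈ C.body
    · obtain ⟨Γ₁, Δ₁, h⟩ := hJ.fact_maximal _ (hfacts A hA)
      exact ⟨Γ₁, Δ₁, fun _ => h⟩
    · exact ⟨∅, ∅, fun h => absurd h hA⟩
  choose Γ₁ Δ₁ h₁ using hex
  have hhas := hD.hyper (σ := contextSubst ν) hC rfl fun A hA => (h₁ A hA).1
  -- Where there is no parent, the Hyper conclusion must avoid `y` to be relevant. A head variable
  -- also occurs in the body, and the facts of such a state do not contain `y`.
  have hvisz (i : ℕ) (hi : ∃ A ∈ C.body, A.HasVar (.z i)) :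
      (state root (ν .x)).p ∨ ¬ (contextSubst ν (.z i)).HasVar .y := by
    obtain ⟨A, hA, hAi⟩ := hi
    refine (hJ.fact_visible _ (hfacts A hA)).imp_right fun h hy => h ?_
    rcases hdl.body A hA with B | ⟨S, j⟩ | ⟨S, j⟩
    · simp [Atom.HasVar, FTerm.HasVar] at hAi
    · obtain rfl : i = j := by simpa [Atom.HasVar, FTerm.HasVar] using hAi
      exact .inr hy
    · obtain rfl : i = j := by simpa [Atom.HasVar, FTerm.HasVar] using hAi
      exact .inl hy
  have hvis (L : Literal F P₁ P₂) (hL : L ∈ C.head) :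
      (L.subst (contextSubst ν)).Visible (state root (ν .x)).p := by
    by_cases hp : (state root (ν .x)).p
    · exact fun _ _ => .inl hp
    have hz (i : ℕ) (hi : ∃ t ∈ L.sides, t.HasVar (.z i)) :
        ¬ (contextSubst ν (.z i)).HasVar .y :=
      (hvisz i (hdl.safe i ⟨L, hL, hi⟩)).resolve_left hp
    have hx : contextSubst ν .x = .x := rfl
    rcases hdl.head L hL with hA | ⟨pos, f, g⟩ | ⟨pos, f, i⟩ | ⟨pos, i, j⟩
    · rw [Atom.lit_subst, Literal.visible_lit]
      right
      rcases hA with ⟨B, i⟩ | _ | _ | ⟨S, i⟩ | ⟨S, i⟩ | _ | _ <;>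
        simp [Term.HasVar, Atom.HasVar, Atom.subst, FTerm.subst, FTerm.HasVar, hx]
      all_goals exact hz i (by simp [Atom.lit, Literal.eq, Term.HasVar, Atom.HasVar, FTerm.HasVar])
    · simp [Literal.subst, Literal.visible_mk, Term.Visible, Term.subst, FTerm.subst, Term.HasVar,
        FTerm.HasVar, hx]
    · simp [Literal.subst, Literal.visible_mk, Term.Visible, Term.subst, FTerm.subst, Term.HasVar,
        FTerm.HasVar, hx, hz i (by simp [Term.HasVar, FTerm.HasVar])]
    · simp [Literal.subst, Literal.visible_mk, Term.Visible, Term.subst, FTerm.subst, Term.HasVar,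
        hz i (by simp [Term.HasVar, FTerm.HasVar]), hz j (by simp [Term.HasVar, FTerm.HasVar])]
  obtain ⟨L, hL, hL'⟩ := hJ.exists_holds hhas (by
      simp only [Finset.coe_biUnion, Set.iUnion_subset_iff]
      exact fun A hA => (h₁ A hA).2.1) fun L hL => by
    rcases Finset.mem_union.1 hL with hL | hL
    · obtain ⟨L, hLC, rfl⟩ := Finset.mem_image.1 hL
      exact hvis L hLC
    · obtain ⟨A, hA, hL⟩ := Finset.mem_biUnion.1 hL
      exact ((h₁ A hA).2.2 L hL).1
  rcases Finset.mem_union.1 hL with hL | hL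
  swap
  · obtain ⟨A, hA, hL⟩ := Finset.mem_biUnion.1 hL
    exact absurd hL' ((h₁ A hA).2.2 L hL).2
  obtain ⟨L, hLC, rfl⟩ := Finset.mem_image.1 hL
  clear hL
  refine ⟨L, hLC, ?_⟩
  have dz (i : ℕ) (hi : ∃ t ∈ L.sides, t.HasVar (.z i)) :=
    denotes_z hD hroot hC hbody (hdl.safe i ⟨L, hLC, hi⟩)
  have df := denotes_fx hroot ν
  rcases hdl.head L hLC with hA | ⟨pos, f, g⟩ | ⟨pos, f, i⟩ | ⟨pos, i, j⟩
  · rw [Atom.lit_subst, LocalInterp.holds_lit] at hL'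
    rw [Interp.holdsL_lit]
    have hun {B t} (h : (Atom.un B t).lit ∈ C.head) : O.HasUnary B :=
      ⟨C, hC, t, .inr ⟨_, h, by simp [Atom.lit, Literal.eq]⟩⟩
    have hz (i) (h) := dz i ⟨_, Sym2.mem_mk_left _ _, h⟩
    have hxσ : (FTerm.x : FTerm F).subst (contextSubst ν) = .x := rfl
    rcases hA with ⟨B, i⟩ | B | ⟨B, f⟩ | ⟨S, i⟩ | ⟨S, i⟩ | ⟨S, f⟩ | ⟨S, f⟩ <;>
      simp only [Atom.subst, Atom.mapF, hxσ, hx] at hL'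
    · exact holds_un hroot (hun hLC) (hz i (by simp [Term.HasVar, Atom.HasVar, FTerm.HasVar])) hL'
    · exact .inl hL'
    · exact holds_un hroot (hun hLC) (df f) hL'
    · exact holds_bin_left (hz i (by simp [Term.HasVar, Atom.HasVar, FTerm.HasVar])) hL'
    · exact holds_bin_right (hz i (by simp [Term.HasVar, Atom.HasVar, FTerm.HasVar])) hL'
    · exact holds_bin_left (df f) hL'
    · exact holds_bin_right (df f) hL'
  · exact holdsL_of_holds (df f) (df g) hL'
  · exact holdsL_of_holds (df f) (dz i (by simp [Term.HasVar, FTerm.HasVar])) hL'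
  · exact holdsL_of_holds (dz i (by simp [Term.HasVar, FTerm.HasVar]))
      (dz j (by simp [Term.HasVar, FTerm.HasVar])) hL'

end Model

/-! ### The root state and the query -/

theorem refutable_root {q : V} {Q : Clause F P₁ P₂} (hQ : IsQueryClause Q)
    (C2 : ∀ A : Atom F P₁ P₂, A.lit ∈ Q.head → ∀ s : Term F P₁ P₂, IsContextTerm s →
      s ≠ .fterm .x → s ≠ .fterm .y → D.gt q (.atom A) s →
      ∃ A' : Atom F P₁ P₂, s = .atom A' ∧ (A'.lit ∈ Q.head ∨ A' ∈ Pr O))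
    (C3 : ∀ A ∈ Q.body, D.Has q ⟨Q.body, {A.lit}⟩) (hn : ¬ D.Has q Q) :
    D.Refutable q False Q.body {A | A.lit ∈ Q.head} := by
  refine ⟨fun C hC hbody hhead => hn (.inr (.inr ⟨C, hC, Finset.coe_subset.1 hbody, ?_⟩)),
    fun A hA => ?_, fun A hA => ?_, fun A hA => ?_, fun A hA s hs hsx hsy hv hgt => ?_⟩
  · intro L hL
    obtain ⟨A, hA, rfl⟩ := hhead L hL
    exact hA
  · obtain ⟨C, hC, hCb, hCh⟩ := (C3 A hA).exists_subset_of_atoms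
      fun L hL => ⟨A, Finset.mem_singleton.1 hL⟩
    exact ⟨C, hC, Finset.coe_subset.2 hCb, hCh⟩
  · obtain ⟨B, rfl⟩ := hQ.body A hA
    simp [Term.Visible, Term.HasVar, Atom.HasVar, FTerm.HasVar]
  · obtain ⟨B, e⟩ := hQ.head _ hA
    rw [Atom.lit_injective e]
    exact .Bx B
  -- C2 permits predecessor triggers below a query atom. They contain `y` and so are invisible at
  -- the root.
  · obtain ⟨A', rfl, hA' | hA'⟩ := C2 A hA s hs hsx hsy hgt
    · exact ⟨A', hA', rfl⟩
    · exfalso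
      rcases cases_of_mem_Pr hA' with ⟨B, rfl⟩ | ⟨S, rfl⟩ | ⟨S, rfl⟩ <;>
        simp [Term.Visible, Term.HasVar, Atom.HasVar, FTerm.HasVar] at hv

end ContextStructure

end ConsequenceBased

theorem mainTheorem2 {F P₁ P₂ : Type u} [Countable F] [Countable P₁] [Countable P₂]
    [LinearOrder F] [WellFoundedLT F]
    (O : ConsequenceBased.Ontology F P₁ P₂) {V : Type*}
    (D : ConsequenceBased.ContextStructure O V) (hD : D.Saturated)
    (q : V) (Q : ConsequenceBased.Clause F P₁ P₂) (hQ : ConsequenceBased.IsQueryClause Q)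
    (C1 : ConsequenceBased.Entails (O.clauses : Set (ConsequenceBased.Clause F P₁ P₂)) Q)
    (C2 : ∀ A : ConsequenceBased.Atom F P₁ P₂, A.lit ∈ Q.head →
      ∀ s : ConsequenceBased.Term F P₁ P₂, ConsequenceBased.IsContextTerm s →
        s ≠ .fterm .x → s ≠ .fterm .y → D.gt q (.atom A) s →
        ∃ A' : ConsequenceBased.Atom F P₁ P₂,
          s = .atom A' ∧ (A'.lit ∈ Q.head ∨ A' ∈ ConsequenceBased.Pr O))
    (C3 : ∀ A ∈ Q.body, D.Has q ⟨Q.body, {A.lit}⟩) :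
    D.Has q Q := by
  by_contra hn
  obtain ⟨J, hJ⟩ := (ConsequenceBased.ContextStructure.refutable_root hQ C2 C3 hn).exists_isLocalModel hD
  let root : ConsequenceBased.ContextStructure.LocalState D := ⟨q, False, _, _, J, hJ⟩
  have hroot : ¬ root.p := id
  have hx := hJ.nf_var .x
  obtain ⟨L, hL, hL'⟩ := C1 (List F) (ConsequenceBased.ContextStructure.treeModel root) (fun C hC => ConsequenceBased.ContextStructure.treeModel_models hD hroot hC)
    (fun _ => []) fun A hA => by
      have hA' := hJ.true_body A hA
      obtain ⟨B, rfl⟩ := hQ.body A hA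
      simp only [ConsequenceBased.Atom.mapF, hx] at hA'
      exact .inl hA'
  obtain ⟨B, rfl⟩ := hQ.head L hL
  rw [ConsequenceBased.Interp.holdsL_lit] at hL'
  -- The empty list is nobody's child, so unary atoms at the root are decided by the root's own
  -- facts.
  rcases hL' with h | ⟨f, l, e, -⟩
  · exact hJ.false_head _ hL h
  · exact absurd e (by simp [ConsequenceBased.Interp.evalF])
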